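/- Let $A$ be an Artin algebra over a commutative Artinian ring $R$, and let $D=\mathrm{Hom}_R(-,J)$ be the usual duality, $J$ an injective envelope of $R/\mathrm{rad}\,R$. Modules are left modules, $A$-mod is the category of finitely generated modules, and maps in endomorphism rings are composed from left to right, so that $\mathrm{Hom}_A(V,-)$ is a left $\mathrm{End}_A(V)$-module. Conventions. A module $T$ over a ring $B$ is *tilting* if (1) it has a finite resolution by finitely generated projective modules, (2) $\mathrm{Ext}^i_B(T,T)=0$ for all $i>0$, and (3) there is an exact sequence $0\to B\to T^0\to\cdots\to T^m\to0$ with all $T^i\in\mathrm{add}\,T$. Rings $B$ and $C$ are *derived equivalent via $T$* (the derived equivalence is *given by* $T$) if $T$ is a tilting $B$-module and $C\cong\mathrm{End}_B(T)$. A sequence $X\xrightarrow{f}M'\xrightarrow{g}Y$ in $A$-mod is *almost $\mathrm{add}(M)$-split* if $M'\in\mathrm{add}\,M$, $f$ is a left and $g$ a right $\mathrm{add}(M)$-approximation, $f$ is a kernel of $g$ and $g$ is a cokernel of $f$. The module attached to such a sequence is the module $$T_{f}=\mathrm{Coker}\big(\mathrm{Hom}_A(V,X)\xrightarrow{(f,0)_*}\mathrm{Hom}_A(V,M'\oplus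 M)\big),\qquad V=M\oplus X,$$ over $\mathrm{End}_A(V)$; it is the module giving the derived equivalence between $\mathrm{End}_A(M\oplus X)$ and $\mathrm{End}_A(M\oplus Y)$. A *BB-tilting module* over an Artin algebra $B$ is a module isomorphic to $\tau^{-1}S\oplus P$, where $\tau^{-1}=\mathrm{Tr}D$, $S$ is a non-injective simple $B$-module with $\mathrm{proj.dim}(\tau^{-1}S)\le1$ and $\mathrm{Ext}^1_B(S,S)=0$, and ${}_BB\cong P(S)\oplus P$ with $P(S)$ the projective cover of $S$ and no direct summand of $P$ isomorphic to $P(S)$. If $S$ is moreover projective, it is called an *APR-tilting module* (the conditions on $\tau^{-1}S$ and $\mathrm{Ext}^1_B(S,S)$ are then automatic). **Proposition.** (1) Let $0\to X\xrightarrow{f}M\xrightarrow{g}Y\to0$ be an Auslander–Reiten sequence in $A$-mod, and put $\Lambda=\mathrm{End}_A(M\oplus X)$ and $\Gamma=\mathrm{End}_A(M\oplus Y)$. Then the sequence is almost $\mathrm{add}(M)$-split, $\Lambda$ and $\Gamma$ are derived equivalent via the $\Lambda$-module $T_f$ (formed with $M'=M$), and $T_f$ is a BB-tilting $\Lambda$-module.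 (2) Let $S$ be a simple projective non-injective $A$-module, let $e:{}_AA\cong P\oplus S$ where no direct summand of $P$ is isomorphic to $S$, and let $0\to S\xrightarrow{f}P'\xrightarrow{g}\tau^{-1}S\to0$ be an Auslander–Reiten sequence. Then this sequence is almost $\mathrm{add}(P)$-split in $A$-mod, $S$ satisfies the conditions above, so that $T=P\oplus\tau^{-1}S$ is a BB-tilting $A$-module, $A$ and $\mathrm{End}_A(T)$ are derived equivalent via $T$, and $T_f$ (formed with $M=P$, $X=S$, $M'=P'$), regarded as an $A$-module along the ring isomorphism $A\cong\mathrm{End}_A(P\oplus S)$ induced by $e$, is isomorphic to $T$. -/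

import Mathlib

open CategoryTheory

universe u

section GeneralRing

variable {A : Type u} [Ring A]

/-- `N` is isomorphic to a direct summand of `P`. -/
def IsSummand (A : Type u) [Ring A] (N P : Type u) [AddCommGroup N] [Module A N]
    [AddCommGroup P] [Module A P] : Prop :=
  ∃ (i : N →ₗ[A] P) (p : P →ₗ[A] N), p ∘ₗ i = LinearMap.id

/-- `N` lies in `add T`: it is a direct summand of a finite direct sum of copies of `T`. -/
def InAdd (A : Type u) [Ring A] (T N : Type u) [AddCommGroup T] [Module A T]
    [AddCommGroup N] [Module A N] : Prop :=
  ∃ n : ℕ, IsSummand A N (Fin n → T)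

/-- A nonzero module with no nontrivial direct sum decomposition. -/
def IsIndecomposableModule (A : Type u) [Ring A] (X : Type u) [AddCommGroup X] [Module A X] :
    Prop :=
  Nontrivial X ∧ ∀ K L : Submodule A X, IsCompl K L → K = ⊥ ∨ L = ⊥

/-- An Auslander-Reiten sequence `0 → X → M → Y → 0` in the category of finitely generated
`A`-modules. -/
structure IsARSequence {X M Y : Type u} [AddCommGroup X] [Module A X] [AddCommGroup M]
    [Module A M] [AddCommGroup Y] [Module A Y] (f : X →ₗ[A] M) (g : M →ₗ[A] Y) : Prop where
  finite_left : Module.Finite A X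
  finite_mid : Module.Finite A M
  finite_right : Module.Finite A Y
  injective : Function.Injective f
  exact : Function.Exact f g
  surjective : Function.Surjective g
  not_split : ¬ ∃ s : Y →ₗ[A] M, g ∘ₗ s = LinearMap.id
  indec_left : IsIndecomposableModule A X
  indec_right : IsIndecomposableModule A Y
  right_almost_split : ∀ (N : Type u) [AddCommGroup N] [Module A N] [Module.Finite A N]
    (h : N →ₗ[A] Y), (¬ ∃ s : Y →ₗ[A] N, h ∘ₗ s = LinearMap.id) →
      ∃ h' : N →ₗ[A] M, g ∘ₗ h' = h
  left_almost_split : ∀ (N : Type u) [AddCommGroup N] [Module A N] [Module.Finite A N]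
    (h : X →ₗ[A] N), (¬ ∃ r : N →ₗ[A] X, r ∘ₗ h = LinearMap.id) →
      ∃ h' : M →ₗ[A] N, h' ∘ₗ f = h

/-- `X → M' → Y` is an almost `add M`-split sequence in the category of finitely generated
`A`-modules: `M' ∈ add M`, `f` is a left and `g` a right `add M`-approximation, `f` is a kernel
of `g` and `g` is a cokernel of `f`. -/
structure IsAlmostAddSplit (M : Type u) [AddCommGroup M] [Module A M] {X M' Y : Type u}
    [AddCommGroup X] [Module A X] [AddCommGroup M'] [Module A M'] [AddCommGroup Y] [Module A Y]
    (f : X →ₗ[A] M') (g : M' →ₗ[A] Y) : Prop where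
  mem_add : InAdd A M M'
  left_approx : ∀ (N : Type u) [AddCommGroup N] [Module A N], InAdd A M N →
    ∀ h : X →ₗ[A] N, ∃ h' : M' →ₗ[A] N, h' ∘ₗ f = h
  right_approx : ∀ (N : Type u) [AddCommGroup N] [Module A N], InAdd A M N →
    ∀ h : N →ₗ[A] Y, ∃ h' : N →ₗ[A] M', g ∘ₗ h' = h
  comp_eq_zero : g ∘ₗ f = 0
  isKernel : ∀ (N : Type u) [AddCommGroup N] [Module A N] [Module.Finite A N]
    (h : N →ₗ[A] M'), g ∘ₗ h = 0 → ∃! h' : N →ₗ[A] X, f ∘ₗ h' = h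
  isCokernel : ∀ (N : Type u) [AddCommGroup N] [Module A N] [Module.Finite A N]
    (h : M' →ₗ[A] N), h ∘ₗ f = 0 → ∃! h' : Y →ₗ[A] N, h' ∘ₗ g = h

/-- There is an exact sequence `0 → P_n → ⋯ → P_0 → N → 0` with all `P_i` finitely generated
projective (obtained by splicing short exact sequences). -/
def HasFGProjResolution (A : Type u) [Ring A] : ℕ → ModuleCat.{u} A → Prop
  | 0, N => Module.Finite A N ∧ Module.Projective A N
  | n + 1, N => ∃ (Q : ModuleCat.{u} A) (π : Q →ₗ[A] N), Module.Finite A Q ∧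
      Module.Projective A Q ∧ Function.Surjective π ∧
      HasFGProjResolution A n (ModuleCat.of A (LinearMap.ker π))

/-- There is an exact sequence `0 → N → T^0 → ⋯ → T^m → 0` with all `T^i` in `add T`
(obtained by splicing short exact sequences). -/
def HasAddCoresolution (A : Type u) [Ring A] (T : Type u) [AddCommGroup T] [Module A T] :
    ℕ → ModuleCat.{u} A → Prop
  | 0, N => InAdd A T N
  | m + 1, N => ∃ (T₀ : ModuleCat.{u} A) (ι : N →ₗ[A] T₀), InAdd A T T₀ ∧
      Function.Injective ι ∧
      HasAddCoresolution A T m (ModuleCat.of A (T₀ ⧸ LinearMap.range ι))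

/-- Tilting modules over an arbitrary ring. -/
structure IsTiltingModule (A : Type u) [Ring A] (T : Type u) [AddCommGroup T] [Module A T] :
    Prop where
  resolution : ∃ n, HasFGProjResolution A n (ModuleCat.of A T)
  ext_eq_zero : ∀ i : ℕ, 0 < i →
    Subsingleton (Abelian.Ext.{u} (ModuleCat.of A T) (ModuleCat.of A T) i)
  coresolution : ∃ m, HasAddCoresolution A T m (ModuleCat.of A A)

/-- The rings `A` and `B` are derived equivalent via the tilting `A`-module `T`: the module `T` is
tilting and `B` is its endomorphism ring. Morphisms are composed from left to right when they
are multiplied in an endomorphism ring, hence the opposite of Mathlib's `Module.End`. -/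
def DerivedEquivalentVia (A B : Type u) [Ring A] [Ring B] (T : Type u) [AddCommGroup T]
    [Module A T] : Prop :=
  IsTiltingModule A T ∧ Nonempty (B ≃+* (Module.End A T)ᵐᵒᵖ)

/-- `K` is a superfluous (small) submodule. -/
def IsSuperfluous {P : Type u} [AddCommGroup P] [Module A P] (K : Submodule A P) : Prop :=
  ∀ L : Submodule A P, K ⊔ L = ⊤ → L = ⊤

/-- `π : Q → S` is a projective cover. -/
structure IsProjectiveCover {Q S : Type u} [AddCommGroup Q] [Module A Q] [AddCommGroup S]
    [Module A S] (π : Q →ₗ[A] S) : Prop where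
  projective : Module.Projective A Q
  surjective : Function.Surjective π
  superfluous : IsSuperfluous (LinearMap.ker π)

/-- `P₁ → P₀ → N → 0` is a minimal projective presentation by finitely generated modules:
`P₀ → N` is a projective cover and so is `P₁ → ker (P₀ → N)`. -/
structure IsMinimalProjPresentation {P₁ P₀ N : Type u} [AddCommGroup P₁] [Module A P₁]
    [AddCommGroup P₀] [Module A P₀] [AddCommGroup N] [Module A N]
    (d : P₁ →ₗ[A] P₀) (ε : P₀ →ₗ[A] N) : Prop where
  finite_one : Module.Finite A P₁
  finite_zero : Module.Finite A P₀
  projective_one : Module.Projective A P₁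
  exact : Function.Exact d ε
  superfluous_one : IsSuperfluous (LinearMap.ker d)
  cover : IsProjectiveCover ε

/-- The ring `A` is `P(S) ⊕ P` as a left module, where `P(S)` is the projective cover of `S`, and
no direct summand of `P` is isomorphic to `P(S)`. -/
def IsProjCoverComplement (A : Type u) [Ring A] (S P : Type u) [AddCommGroup S] [Module A S]
    [AddCommGroup P] [Module A P] : Prop :=
  ∃ (Q : ModuleCat.{u} A) (π : Q →ₗ[A] S), IsProjectiveCover π ∧
    Nonempty (A ≃ₗ[A] Q × P) ∧ ¬ IsSummand A Q P

/-- For a homomorphism `d : P₁ → P₀` of right `A`-modules, the homomorphism of left `A`-modules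
`Hom(P₀, A) → Hom(P₁, A)`, `φ ↦ φ ∘ d`. Right modules are modules over `Aᵐᵒᵖ`. -/
def dualMapRight {P₁ P₀ : Type u} [AddCommGroup P₁] [Module Aᵐᵒᵖ P₁]
    [AddCommGroup P₀] [Module Aᵐᵒᵖ P₀] (d : P₁ →ₗ[Aᵐᵒᵖ] P₀) :
    (P₀ →ₗ[Aᵐᵒᵖ] A) →ₗ[A] (P₁ →ₗ[Aᵐᵒᵖ] A) where
  toFun φ := φ ∘ₗ d
  map_add' _ _ := rfl
  map_smul' _ _ := rfl

/-- The abelian group `Hom_A(V, X)`, made into a left module over the endomorphism ring of `V`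
below. -/
def HomMod (A : Type u) [Ring A] (V X : Type u) [AddCommGroup V] [Module A V]
    [AddCommGroup X] [Module A X] : Type u := V →ₗ[A] X

section HomMod

variable {V X M : Type u} [AddCommGroup V] [Module A V] [AddCommGroup X] [Module A X]
  [AddCommGroup M] [Module A M]

instance : AddCommGroup (HomMod A V X) := inferInstanceAs (AddCommGroup (V →ₗ[A] X))

/-- An element of `Hom_A(V, X)`, viewed as a linear map. -/
def HomMod.toLin (h : HomMod A V X) : V →ₗ[A] X := h

/-- An endomorphism `b` of `V` acts on `h : V → X` by sending it to "first `b`, then `h`". -/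
instance : Module (Module.End A V)ᵐᵒᵖ (HomMod A V X) where
  smul b h := (h.toLin ∘ₗ b.unop : V →ₗ[A] X)
  one_smul _ := rfl
  mul_smul _ _ _ := rfl
  smul_zero _ := rfl
  smul_add _ _ _ := rfl
  add_smul b c h := LinearMap.comp_add b.unop c.unop h.toLin
  zero_smul h := LinearMap.comp_zero h.toLin

/-- The induced homomorphism `Hom_A(V, X) → Hom_A(V, M)`, `h ↦ f ∘ h`. -/
def homModMap (V : Type u) [AddCommGroup V] [Module A V] (f : X →ₗ[A] M) :
    HomMod A V X →ₗ[(Module.End A V)ᵐᵒᵖ] HomMod A V M where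
  toFun h := (f ∘ₗ h.toLin : V →ₗ[A] M)
  map_add' h k := LinearMap.comp_add h.toLin k.toLin f
  map_smul' _ _ := rfl

end HomMod

/-- The module over `Λ = End_A(V)`, `V = M ⊕ X`, that is attached to an almost `add M`-split
sequence `X → M' → Y`: the cokernel of `Hom_A(V, X) → Hom_A(V, M' ⊕ M)` induced by
`(f, 0) : X → M' ⊕ M`. -/
abbrev ExchangeModule (M : Type u) [AddCommGroup M] [Module A M] {X M' : Type u}
    [AddCommGroup X] [Module A X] [AddCommGroup M'] [Module A M'] (f : X →ₗ[A] M') : Type u :=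
  HomMod A (M × X) (M' × M) ⧸
    LinearMap.range (homModMap (M × X) (LinearMap.inl A M' M ∘ₗ f))

/-- The ring isomorphism `A ≅ End_A(V)` induced by an isomorphism `e : A ≅ V` of left
`A`-modules; it sends `a` to the endomorphism `v ↦ e (e⁻¹(v) * a)`. -/
def ringEquivEndOfEquiv {V : Type u} [AddCommGroup V] [Module A V] (e : A ≃ₗ[A] V) :
    A ≃+* (Module.End A V)ᵐᵒᵖ :=
  (RingEquiv.opOp A).trans (RingEquiv.op ((RingEquiv.moduleEndSelf A).trans e.conjRingEquiv))

end GeneralRing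

section ArtinAlgebra

/-- `J` is an injective envelope of `R / rad R`. -/
def IsInjectiveEnvelopeOfTop (R J : Type u) [CommRing R] [AddCommGroup J] [Module R J] : Prop :=
  Module.Injective R J ∧ ∃ ι : (R ⧸ Ring.jacobson R) →ₗ[R] J, Function.Injective ι ∧
    ∀ N : Submodule R J, N ⊓ LinearMap.range ι = ⊥ → N = ⊥

variable (R A J : Type u) [CommRing R] [Ring A] [Algebra R A] [AddCommGroup J] [Module R J]

/-- The dual `D(S) = Hom_R(S, J)` of a left `A`-module `S`. -/
def ArtinDual (S : Type u) [AddCommGroup S] [Module A S] : Type u := RestrictScalars R A S →ₗ[R] J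

section ArtinDual

variable (S : Type u) [AddCommGroup S] [Module A S]

instance : AddCommGroup (ArtinDual R A J S) :=
  inferInstanceAs (AddCommGroup (RestrictScalars R A S →ₗ[R] J))

variable {R A J S} in
/-- An element of `D(S)`, viewed as an `R`-linear map. -/
def ArtinDual.toLin (φ : ArtinDual R A J S) : RestrictScalars R A S →ₗ[R] J := φ

/-- The right action of `A` on `D(S)`: `(φ · a)(s) = φ(a s)`. -/
instance : Module Aᵐᵒᵖ (ArtinDual R A J S) where
  smul a φ := (φ.toLin ∘ₗ RestrictScalars.lsmul R A S a.unop : RestrictScalars R A S →ₗ[R] J)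
  one_smul φ := congrArg (LinearMap.comp φ.toLin) (map_one (RestrictScalars.lsmul R A S))
  mul_smul a b φ := congrArg (LinearMap.comp φ.toLin)
    (map_mul (RestrictScalars.lsmul R A S) b.unop a.unop)
  smul_zero _ := rfl
  smul_add _ _ _ := rfl
  add_smul a b φ := (congrArg (LinearMap.comp φ.toLin)
    (map_add (RestrictScalars.lsmul R A S) a.unop b.unop)).trans (LinearMap.comp_add _ _ φ.toLin)
  zero_smul φ := (congrArg (LinearMap.comp φ.toLin)
    (map_zero (RestrictScalars.lsmul R A S))).trans (LinearMap.comp_zero φ.toLin)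

end ArtinDual

/-- `Z ≅ τ⁻¹ S = Tr D S`: for a minimal projective presentation `P₁ → P₀ → D S → 0` of the right
module `D S`, the left module `Z` is the cokernel of `Hom(P₀, A) → Hom(P₁, A)`. -/
def IsTrD (S Z : Type u) [AddCommGroup S] [Module A S] [AddCommGroup Z] [Module A Z] : Prop :=
  ∃ (P₁ P₀ : ModuleCat.{u} Aᵐᵒᵖ) (d : P₁ →ₗ[Aᵐᵒᵖ] P₀) (ε : P₀ →ₗ[Aᵐᵒᵖ] ArtinDual R A J S),
    IsMinimalProjPresentation d ε ∧
    Nonempty (Z ≃ₗ[A] ((P₁ →ₗ[Aᵐᵒᵖ] A) ⧸ LinearMap.range (dualMapRight d)))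

/-- The data `S`, `Z = τ⁻¹ S`, `P` from which a BB-tilting module `τ⁻¹ S ⊕ P` is formed. -/
structure IsBBTriple (S Z P : Type u) [AddCommGroup S] [Module A S] [AddCommGroup Z] [Module A Z]
    [AddCommGroup P] [Module A P] : Prop where
  simple : IsSimpleModule A S
  not_injective : ¬ Module.Injective A S
  isTrD : IsTrD R A J S Z
  projDim_le_one : HasProjectiveDimensionLE (ModuleCat.of A Z) 1
  ext_one_eq_zero : Subsingleton (Abelian.Ext.{u} (ModuleCat.of A S) (ModuleCat.of A S) 1)
  complement : IsProjCoverComplement A S P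

/-- `T` is a BB-tilting module. -/
def IsBBTilting (T : Type u) [AddCommGroup T] [Module A T] : Prop :=
  ∃ S Z P : ModuleCat.{u} A, IsBBTriple R A J S Z P ∧ Nonempty (T ≃ₗ[A] Z × P)

end ArtinAlgebra

/-! Write `V = M ⊕ X` and `Λ = End(V)`. An Auslander–Reiten sequence says that a map out of `X`
extends along `f` unless it is a split monomorphism, and dually for `g`. A split monomorphism from
`X` into a module of `add M` would make `X` a summand of `M`, because `End(X)` is local. So the
almost split claim in (1) reduces to `not_isSummand_left` and `not_isSummand_right`.

For tilting, `Hom(V, -)` is fully faithful on `add V` with projective values. Applied to `X → M ⊕ M`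
it resolves `T_f`; applied to `M ⊕ X → M ⊕ M` it embeds `Λ` in a module of `add T_f` with cokernel
in `add T_f`. Left approximation kills `Ext¹(T_f, T_f)`, and right approximation identifies
`End(T_f)` with `End(Y ⊕ M)`.

For the BB property, let `S` be the simple top of `Hom(V, X)`. As `X` is not a summand of `M`, there
are no nonzero maps `Hom(V, M) → S`; hence `S` is not injective and `Hom(V, M)` has no summand
`Hom(V, X)`. Nilpotent endomorphisms of `X` factor through `f`, so the radical of `Hom(V, X)` is
generated by maps factoring through `M`, and `Ext¹(S, S) = 0`. The dual `D(S)` is generated by any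
nonzero functional, and the left almost split property gives its minimal presentation `Hom(M, V) →
Hom(X, V) → D(S)`. Dualizing returns `Hom(V, f)`, so `τ⁻¹S = Coker Hom(V, f)` (`isTrD_top`), the
complement of `Hom(V, M)` in `T_f`.

In (2) the main point is that `P'` lies in `add P`. A lift of `f` to a free module stays in the
radical, hence extends over `P'`, and left minimality of `f` makes `P'` a summand of the free module
(`projective_mid`); since `Hom(P', S) = 0`, no copy of `S` is needed. Evaluation at `e 1` then
identifies `T_f` with `P ⊕ τ⁻¹S`. -/

/-! ### Fitting's lemma and local endomorphism rings. -/

section Fitting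

variable {A : Type u} [Ring A] {X Y M : Type u} [AddCommGroup X] [Module A X]
  [AddCommGroup Y] [Module A Y] [AddCommGroup M] [Module A M]

theorem IsIndecomposableModule.isUnit_or_isNilpotent [IsArtinian A X] [IsNoetherian A X]
    (hX : IsIndecomposableModule A X) (t : Module.End A X) : IsUnit t ∨ IsNilpotent t := by
  -- The condition `1 ≤ n` is what lets invertibility of `t ^ n` pass to `t`.
  obtain ⟨n, hn, hn1⟩ := (t.eventually_isCompl_ker_pow_range_pow.and
    (Filter.eventually_ge_atTop 1)).exists
  rcases hX.2 _ _ hn with h | h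
  · left
    have h2 : LinearMap.range (t ^ n) = ⊤ := by simpa [h] using hn.sup_eq_top
    have : IsUnit (t ^ n) := (Module.End.isUnit_iff _).2
      ⟨LinearMap.ker_eq_bot.1 h, LinearMap.range_eq_top.1 h2⟩
    exact (isUnit_pow_iff (by omega)).1 this
  · right
    exact ⟨n, LinearMap.range_eq_bot.1 h⟩

theorem IsIndecomposableModule.isUnit_or_isUnit [IsArtinian A X] [IsNoetherian A X]
    (hX : IsIndecomposableModule A X) {a b : Module.End A X} (hab : a + b = 1) :
    IsUnit a ∨ IsUnit b := by
  rcases hX.isUnit_or_isNilpotent a with h | h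
  · exact .inl h
  · right
    have : b = 1 - a := by rw [← hab]; abel
    rw [this]
    exact h.isUnit_one_sub

theorem isNilpotent_comp_swap {w : X →ₗ[A] Y} {k : Y →ₗ[A] X}
    (h : IsNilpotent (w ∘ₗ k : Module.End A Y)) : IsNilpotent (k ∘ₗ w : Module.End A X) := by
  obtain ⟨n, hn⟩ := h
  refine ⟨n + 1, ?_⟩
  have key : ∀ m : ℕ, (k ∘ₗ w : Module.End A X) ^ (m + 1)
      = k ∘ₗ ((w ∘ₗ k : Module.End A Y) ^ m) ∘ₗ w := by
    intro m
    induction m with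
    | zero => simp [Module.End.one_eq_id]
    | succ m ih =>
      rw [pow_succ, ih, pow_succ]
      rfl
  rw [key, hn]
  simp

/-- The image of `i` is a nonzero direct summand with complement `ker p`, so indecomposability
forces `ker p = 0`. -/
theorem IsIndecomposableModule.isUnit_of_comp_eq_id (hY : IsIndecomposableModule A Y)
    [Nontrivial X] {i : X →ₗ[A] Y} {p : Y →ₗ[A] X} (h : p ∘ₗ i = LinearMap.id) :
    i ∘ₗ p = LinearMap.id := by
  have hpi : ∀ x, p (i x) = x := fun x => LinearMap.congr_fun h x
  have hc : IsCompl (LinearMap.ker p) (LinearMap.range i) := by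
    constructor
    · rw [Submodule.disjoint_def]
      rintro _ hx ⟨x, rfl⟩
      rw [LinearMap.mem_ker, hpi] at hx
      simp [hx]
    · rw [codisjoint_iff, eq_top_iff]
      intro y _
      refine Submodule.mem_sup.2 ⟨y - i (p y), by simp [hpi], i (p y), ⟨_, rfl⟩, by simp⟩
  rcases hY.2 _ _ hc with hk | hr
  · ext y
    apply LinearMap.ker_eq_bot.1 hk
    simp [hpi]
  · exfalso
    obtain ⟨x, hx⟩ := exists_ne (0 : X)
    apply hx
    have : i x ∈ LinearMap.range i := ⟨x, rfl⟩
    rw [hr, Submodule.mem_bot] at this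
    rw [← hpi x, this, map_zero]

theorem IsUnit.exists_left_inverse {t : Module.End A X} (h : IsUnit t) :
    ∃ s : X →ₗ[A] X, s ∘ₗ t = LinearMap.id := by
  obtain ⟨s, hs⟩ := h.exists_left_inv
  exact ⟨s, hs⟩

theorem IsUnit.exists_right_inverse {t : Module.End A X} (h : IsUnit t) :
    ∃ s : X →ₗ[A] X, t ∘ₗ s = LinearMap.id := by
  obtain ⟨s, hs⟩ := h.exists_right_inv
  exact ⟨s, hs⟩

end Fitting

/-! ### Auslander–Reiten sequences, `add`, and almost split sequences. -/

section AR

variable {A : Type u} [Ring A] {X Y M : Type u} [AddCommGroup X] [Module A X]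
  [AddCommGroup Y] [Module A Y] [AddCommGroup M] [Module A M]
  {f : X →ₗ[A] M} {g : M →ₗ[A] Y}

theorem Function.Exact.exists_lift {N : Type u} [AddCommGroup N] [Module A N]
    (hf : Function.Injective f) (h : Function.Exact f g) (k : N →ₗ[A] M) (hk : g ∘ₗ k = 0) :
    ∃ k' : N →ₗ[A] X, f ∘ₗ k' = k := by
  have hr : ∀ n, k n ∈ LinearMap.range f := fun n => (h (k n)).1 (LinearMap.congr_fun hk n)
  refine ⟨(LinearEquiv.ofInjective f hf).symm ∘ₗ k.codRestrict _ hr, ?_⟩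
  ext n
  have := (LinearEquiv.ofInjective f hf).apply_symm_apply (k.codRestrict _ hr n)
  exact congrArg Subtype.val this

theorem Function.Exact.exists_desc {N : Type u} [AddCommGroup N] [Module A N]
    (hg : Function.Surjective g) (h : Function.Exact f g) (k : M →ₗ[A] N) (hk : k ∘ₗ f = 0) :
    ∃ k' : Y →ₗ[A] N, k' ∘ₗ g = k := by
  have hle : LinearMap.ker g ≤ LinearMap.ker k := by
    intro m hm
    obtain ⟨x, rfl⟩ := (h m).1 hm
    exact LinearMap.congr_fun hk x
  refine ⟨(LinearMap.ker g).liftQ k hle ∘ₗ (g.quotKerEquivOfSurjective hg).symm, ?_⟩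
  ext m
  have : (g.quotKerEquivOfSurjective hg).symm (g m) = Submodule.Quotient.mk m := by
    rw [LinearEquiv.symm_apply_eq]
    rfl
  simp [this]

namespace IsARSequence

theorem comp_eq_zero (h : IsARSequence f g) : g ∘ₗ f = 0 := by
  ext x
  exact h.exact.apply_apply_eq_zero x

theorem left_not_split (h : IsARSequence f g) : ¬ ∃ r : M →ₗ[A] X, r ∘ₗ f = LinearMap.id := by
  rintro ⟨r, hr⟩
  apply h.not_split
  obtain ⟨s, hs⟩ := h.exact.exists_desc h.surjective (LinearMap.id - f ∘ₗ r) (by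
    ext x
    simpa using sub_eq_zero.2 (congrArg f (LinearMap.congr_fun hr x).symm))
  refine ⟨s, ?_⟩
  ext y
  obtain ⟨m, rfl⟩ := h.surjective y
  have := congrArg g (LinearMap.congr_fun hs m)
  simpa [h.exact.apply_apply_eq_zero] using this

variable [IsArtinianRing A]

theorem isArtinian_left (h : IsARSequence f g) : IsArtinian A X :=
  have := h.finite_left; inferInstance

theorem isNoetherian_left (h : IsARSequence f g) : IsNoetherian A X :=
  have := h.finite_left; inferInstance

theorem isArtinian_right (h : IsARSequence f g) : IsArtinian A Y :=
  have := h.finite_right; inferInstance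

theorem isNoetherian_right (h : IsARSequence f g) : IsNoetherian A Y :=
  have := h.finite_right; inferInstance

theorem isNilpotent_comp_left (h : IsARSequence f g) (r : M →ₗ[A] X) :
    IsNilpotent (r ∘ₗ f : Module.End A X) := by
  have := h.isArtinian_left
  have := h.isNoetherian_left
  refine (h.indec_left.isUnit_or_isNilpotent _).resolve_left fun hu => ?_
  obtain ⟨s, hs⟩ := hu.exists_left_inverse
  exact h.left_not_split ⟨s ∘ₗ r, hs⟩

theorem isNilpotent_comp_right (h : IsARSequence f g) (s : Y →ₗ[A] M) :
    IsNilpotent (g ∘ₗ s : Module.End A Y) := by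
  have := h.isArtinian_right
  have := h.isNoetherian_right
  refine (h.indec_right.isUnit_or_isNilpotent _).resolve_left fun hu => ?_
  obtain ⟨t, ht⟩ := hu.exists_right_inverse
  exact h.not_split ⟨s ∘ₗ t, ht⟩

/-- If `p ∘ i = 1` on `X`, the endomorphism `t = p ∘ f` is neither injective nor surjective. The
corestriction of `t` to its image is then not a split monomorphism, so it extends along `f` to some
`q`. The difference between `q` and `p` factors through `g`, which writes the identity of `X` as a
sum of two endomorphisms; whichever is invertible either makes `t` surjective or splits `g`. -/
theorem not_isSummand_left (h : IsARSequence f g) : ¬ IsSummand A X M := by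
  rintro ⟨i, p, hpi⟩
  have := h.isArtinian_left
  have := h.isNoetherian_left
  have := h.indec_left.1
  have := h.finite_left
  set t : Module.End A X := p ∘ₗ f with ht
  have htn : ¬ IsUnit t := fun hu => by
    obtain ⟨s, hs⟩ := hu.exists_left_inverse
    exact h.left_not_split ⟨s ∘ₗ p, hs⟩
  have htinj : ¬ Function.Injective t := fun hi =>
    htn ((Module.End.isUnit_iff _).2 (IsArtinian.bijective_of_injective_endomorphism t hi))
  have htsurj : ¬ Function.Surjective t := fun hs =>
    htn ((Module.End.isUnit_iff _).2 (IsNoetherian.bijective_of_surjective_endomorphism t hs))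
  obtain ⟨q, hq⟩ := h.left_almost_split (LinearMap.range t) t.rangeRestrict (by
    rintro ⟨r, hr⟩
    refine htinj fun a b hab => ?_
    have h1 : t.rangeRestrict a = t.rangeRestrict b := Subtype.ext hab
    have := congrArg r h1
    simpa using (LinearMap.congr_fun hr a).symm.trans (this.trans (LinearMap.congr_fun hr b)))
  obtain ⟨r, hr⟩ := h.exact.exists_desc h.surjective ((LinearMap.range t).subtype ∘ₗ q - p) (by
    rw [LinearMap.sub_comp, LinearMap.comp_assoc, hq]
    ext x; simp [ht])
  have h1 : ((LinearMap.range t).subtype ∘ₗ q ∘ₗ i : Module.End A X)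
      + (-(r ∘ₗ g ∘ₗ i) : Module.End A X) = 1 := by
    ext x
    have := LinearMap.congr_fun hr (i x)
    have h2 := LinearMap.congr_fun hpi x
    simp at this h2
    simp [this, h2]
  rcases h.indec_left.isUnit_or_isUnit h1 with hu | hu
  · apply htsurj
    intro x
    obtain ⟨y, hy⟩ := ((Module.End.isUnit_iff _).1 hu).2 x
    obtain ⟨z, hz⟩ := (q (i y)).2
    exact ⟨z, hz.trans hy⟩
  · rw [IsUnit.neg_iff] at hu
    obtain ⟨s, hs⟩ := hu.exists_left_inverse
    have hs' : (s ∘ₗ r) ∘ₗ (g ∘ₗ i) = LinearMap.id := hs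
    have := h.indec_right.isUnit_of_comp_eq_id hs'
    exact h.not_split ⟨i ∘ₗ s ∘ₗ r, this⟩

/-- Dual argument: with `t = g ∘ i`, the inclusion of the image of `t` lifts along `g`, and the
error term factors through `f`. -/
theorem not_isSummand_right (h : IsARSequence f g) : ¬ IsSummand A Y M := by
  rintro ⟨i, p, hpi⟩
  have := h.isArtinian_right
  have := h.isNoetherian_right
  have := h.indec_left.1
  have := h.indec_right.1
  have := h.finite_right
  set t : Module.End A Y := g ∘ₗ i with ht
  have htn : ¬ IsUnit t := fun hu => by
    obtain ⟨s, hs⟩ := hu.exists_right_inverse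
    exact h.not_split ⟨i ∘ₗ s, hs⟩
  have htinj : ¬ Function.Injective t := fun hi =>
    htn ((Module.End.isUnit_iff _).2 (IsArtinian.bijective_of_injective_endomorphism t hi))
  have htsurj : ¬ Function.Surjective t := fun hs =>
    htn ((Module.End.isUnit_iff _).2 (IsNoetherian.bijective_of_surjective_endomorphism t hs))
  obtain ⟨q, hq⟩ := h.right_almost_split (LinearMap.range t) (LinearMap.range t).subtype (by
    rintro ⟨r, hr⟩
    refine htsurj fun a => ?_
    obtain ⟨z, hz⟩ := (r a).2
    exact ⟨z, hz.trans (LinearMap.congr_fun hr a)⟩)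
  obtain ⟨r, hr⟩ := h.exact.exists_lift h.injective (i - q ∘ₗ t.rangeRestrict) (by
    rw [LinearMap.comp_sub, ← LinearMap.comp_assoc, hq]
    ext x; simp [ht])
  have h1 : (p ∘ₗ q ∘ₗ t.rangeRestrict : Module.End A Y)
      + (p ∘ₗ f ∘ₗ r : Module.End A Y) = 1 := by
    ext x
    have := LinearMap.congr_fun hr x
    have h2 := LinearMap.congr_fun hpi x
    simp at this h2
    simp [this, h2]
  rcases h.indec_right.isUnit_or_isUnit h1 with hu | hu
  · apply htinj
    intro a b hab
    apply ((Module.End.isUnit_iff _).1 hu).1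
    have h1 : t.rangeRestrict a = t.rangeRestrict b := Subtype.ext hab
    simp [h1]
  · obtain ⟨s, hs⟩ := hu.exists_left_inverse
    have hs' : (s ∘ₗ p ∘ₗ f) ∘ₗ r = LinearMap.id := hs
    have := h.indec_left.isUnit_of_comp_eq_id hs'
    exact h.left_not_split ⟨r ∘ₗ s ∘ₗ p, this⟩

theorem isNilpotent_comp_comp (h : IsARSequence f g) (a : X →ₗ[A] M) (b : M →ₗ[A] X) :
    IsNilpotent (b ∘ₗ a : Module.End A X) := by
  have := h.isArtinian_left
  have := h.isNoetherian_left
  refine (h.indec_left.isUnit_or_isNilpotent _).resolve_left fun hu => ?_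
  obtain ⟨s, hs⟩ := hu.exists_left_inverse
  exact h.not_isSummand_left ⟨a, s ∘ₗ b, hs⟩

end IsARSequence

/-- The identity of `X` is a sum of endomorphisms factoring through single copies of `M`; in a local
ring one of the terms must be invertible. -/
theorem IsIndecomposableModule.isSummand_of_inAdd [IsArtinian A X] [IsNoetherian A X]
    (hX : IsIndecomposableModule A X) (h : InAdd A M X) : IsSummand A X M := by
  obtain ⟨n, i, p, hpi⟩ := h
  by_contra hc
  have hnil : ∀ (a : X →ₗ[A] M) (b : M →ₗ[A] X), ¬ IsUnit (b ∘ₗ a : Module.End A X) := by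
    intro a b hu
    obtain ⟨s, hs⟩ := hu.exists_left_inverse
    exact hc ⟨a, s ∘ₗ b, hs⟩
  let c : Fin n → Module.End A X := fun j =>
    (p ∘ₗ LinearMap.single A (fun _ => M) j) ∘ₗ (LinearMap.proj j ∘ₗ i)
  have hsum : ∑ j, c j = 1 := by
    ext x
    have h2 := LinearMap.congr_fun hpi x
    have h3 : ∑ j, Pi.single j (i x j) = i x := by
      ext j; simp [Finset.sum_apply, Finset.sum_pi_single]
    simp only [LinearMap.comp_apply, LinearMap.id_apply] at h2
    simp only [LinearMap.sum_apply, c, LinearMap.comp_apply, LinearMap.proj_apply,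
      LinearMap.single_apply, ← map_sum, h3, h2]
    rfl
  have key : ∀ s : Finset (Fin n), ¬ IsUnit (∑ j ∈ s, c j) := by
    intro s
    induction s using Finset.induction_on with
    | empty =>
      have := hX.1
      simp
    | insert j s hj ih =>
      rw [Finset.sum_insert hj]
      rintro ⟨v, hv⟩
      have : (↑v⁻¹ * c j) + (↑v⁻¹ * ∑ j ∈ s, c j) = 1 := by
        rw [← mul_add, ← hv, Units.inv_mul]
      rcases hX.isUnit_or_isUnit this with hu | hu
      · rw [Units.isUnit_units_mul] at hu
        exact hnil _ _ hu
      · rw [Units.isUnit_units_mul] at hu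
        exact ih hu
  exact key Finset.univ (hsum ▸ isUnit_one)

theorem InAdd.finite {T N : Type u} [AddCommGroup T] [Module A T] [AddCommGroup N] [Module A N]
    [Module.Finite A T] (h : InAdd A T N) : Module.Finite A N := by
  obtain ⟨n, i, p, hpi⟩ := h
  exact Module.Finite.of_surjective p fun x => ⟨i x, LinearMap.congr_fun hpi x⟩

theorem InAdd.projective {T N : Type u} [AddCommGroup T] [Module A T] [AddCommGroup N] [Module A N]
    [Module.Projective A T] (h : InAdd A T N) : Module.Projective A N := by
  obtain ⟨n, i, p, hpi⟩ := h
  have : Module.Projective A (Fin n → T) :=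
    Module.Projective.of_equiv' (DFinsupp.linearEquivFunOnFintype (R := A) (M := fun _ : Fin n => T))
  exact Module.Projective.of_split i p hpi

theorem IsSummand.trans_inAdd {T N N' : Type u} [AddCommGroup T] [Module A T] [AddCommGroup N]
    [Module A N] [AddCommGroup N'] [Module A N'] (h : IsSummand A N N') (h' : InAdd A T N') :
    InAdd A T N := by
  obtain ⟨i, p, hpi⟩ := h
  obtain ⟨n, i', p', hpi'⟩ := h'
  refine ⟨n, i' ∘ₗ i, p ∘ₗ p', ?_⟩
  rw [LinearMap.comp_assoc, ← LinearMap.comp_assoc i, hpi', LinearMap.id_comp, hpi]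

theorem InAdd.refl (T : Type u) [AddCommGroup T] [Module A T] : InAdd A T T :=
  ⟨1, LinearMap.pi fun _ => LinearMap.id, LinearMap.proj 0, rfl⟩

theorem IsSummand.inAdd {T N : Type u} [AddCommGroup T] [Module A T] [AddCommGroup N]
    [Module A N] (h : IsSummand A N T) : InAdd A T N := h.trans_inAdd (InAdd.refl T)

theorem InAdd.prod {T N N' : Type u} [AddCommGroup T] [Module A T] [AddCommGroup N]
    [Module A N] [AddCommGroup N'] [Module A N'] (h : InAdd A T N) (h' : InAdd A T N') :
    InAdd A T (N × N') := by
  obtain ⟨m, i, p, hpi⟩ := h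
  obtain ⟨n, i', p', hpi'⟩ := h'
  let e : (Fin (m + n) → T) ≃ₗ[A] (Fin m → T) × (Fin n → T) :=
    (LinearEquiv.funCongrLeft A T finSumFinEquiv).trans
      (LinearEquiv.sumArrowLequivProdArrow (Fin m) (Fin n) A T)
  refine ⟨m + n, e.symm ∘ₗ i.prodMap i', p.prodMap p' ∘ₗ e, ?_⟩
  have h1 := LinearMap.congr_fun hpi
  have h2 := LinearMap.congr_fun hpi'
  simp only [LinearMap.comp_apply, LinearMap.id_apply] at h1 h2
  ext x <;> simp [h1, h2]

theorem isSummand_of_linearEquiv {N N' : Type u} [AddCommGroup N]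
    [Module A N] [AddCommGroup N'] [Module A N'] (e : N ≃ₗ[A] N') : IsSummand A N N' :=
  ⟨e, e.symm, by ext; simp⟩

theorem isSummand_prod_left (N N' : Type u) [AddCommGroup N]
    [Module A N] [AddCommGroup N'] [Module A N'] : IsSummand A N (N × N') :=
  ⟨LinearMap.inl A N N', LinearMap.fst A N N', rfl⟩

theorem isSummand_prod_right (N N' : Type u) [AddCommGroup N]
    [Module A N] [AddCommGroup N'] [Module A N'] : IsSummand A N' (N × N') :=
  ⟨LinearMap.inr A N N', LinearMap.snd A N N', rfl⟩

theorem IsARSequence.isAlmostAddSplit [IsArtinianRing A] (h : IsARSequence f g)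
    (N₀ : Type u) [AddCommGroup N₀] [Module A N₀] [Module.Finite A N₀]
    (hM : InAdd A N₀ M) (hX : ¬ IsSummand A X N₀) (hY : ¬ IsSummand A Y N₀) :
    IsAlmostAddSplit N₀ f g where
  mem_add := hM
  left_approx N _ _ hN k := by
    have := h.isArtinian_left
    have := h.isNoetherian_left
    have := hN.finite
    refine h.left_almost_split N k fun ⟨r, hr⟩ => hX ?_
    exact h.indec_left.isSummand_of_inAdd (IsSummand.trans_inAdd ⟨k, r, hr⟩ hN)
  right_approx N _ _ hN k := by
    have := h.isArtinian_right
    have := h.isNoetherian_right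
    have := hN.finite
    refine h.right_almost_split N k fun ⟨r, hr⟩ => hY ?_
    exact h.indec_right.isSummand_of_inAdd (IsSummand.trans_inAdd ⟨r, k, hr⟩ hN)
  comp_eq_zero := h.comp_eq_zero
  isKernel N _ _ _ k hk := by
    obtain ⟨k', hk'⟩ := h.exact.exists_lift h.injective k hk
    refine ⟨k', hk', fun k'' hk'' => ?_⟩
    ext x
    apply h.injective
    exact LinearMap.congr_fun (hk''.trans hk'.symm) x
  isCokernel N _ _ _ k hk := by
    obtain ⟨k', hk'⟩ := h.exact.exists_desc h.surjective k hk
    refine ⟨k', hk', fun k'' hk'' => ?_⟩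
    ext x
    obtain ⟨y, rfl⟩ := h.surjective x
    exact LinearMap.congr_fun (hk''.trans hk'.symm) y

end AR

/-! ### Vanishing of `Ext` and a criterion for tilting modules. -/

section Ext

variable {B : Type u} [Ring B] {K Q T N : Type u} [AddCommGroup K] [Module B K]
  [AddCommGroup Q] [Module B Q] [AddCommGroup T] [Module B T] [AddCommGroup N] [Module B N]
  {i : K →ₗ[B] Q} {q : Q →ₗ[B] T}


/-- As `Q` is projective, each class in `Ext¹(T, N)` is the extension class composed with a map `K →
N`; if that map extends to `Q`, the composite vanishes. -/
theorem subsingleton_ext_one (hi : Function.Injective i) (he : Function.Exact i q)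
    (hq : Function.Surjective q) [Module.Projective B Q]
    (hN : ∀ h : K →ₗ[B] N, ∃ h' : Q →ₗ[B] N, h' ∘ₗ i = h) :
    Subsingleton (Abelian.Ext.{u} (ModuleCat.of B T) (ModuleCat.of B N) 1) := by
  let S : ShortComplex (ModuleCat.{u} B) := ShortComplex.mk (ModuleCat.ofHom i) (ModuleCat.ofHom q)
    (by ext x; exact he.apply_apply_eq_zero x)
  have hS : S.ShortExact := ModuleCat.shortComplex_shortExact S he hi hq
  have : Projective S.X₂ := by
    change Projective (ModuleCat.of B Q)
    infer_instance
  refine subsingleton_of_forall_eq 0 fun x => ?_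
  obtain ⟨y, rfl⟩ := Abelian.Ext.contravariant_sequence_exact₃ hS (ModuleCat.of B N) x
    (Abelian.Ext.eq_zero_of_projective _) (add_comm 1 0)
  obtain ⟨h, rfl⟩ := Abelian.Ext.addEquiv₀.symm.surjective y
  obtain ⟨h', hh'⟩ := hN h.hom
  have : h = S.f ≫ ModuleCat.ofHom h' := by
    ext x
    exact (LinearMap.congr_fun hh' x).symm
  rw [this]
  have h2 : (Abelian.Ext.mk₀ (S.f ≫ ModuleCat.ofHom h')) =
      (Abelian.Ext.mk₀ S.f).comp (Abelian.Ext.mk₀ (ModuleCat.ofHom h')) (zero_add 0) :=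
    (Abelian.Ext.mk₀_comp_mk₀ _ _).symm
  exact (congrArg (fun z => hS.extClass.comp z (add_comm 1 0)) h2).trans
    (hS.extClass_comp_assoc _)

theorem subsingleton_ext_one_quotient [Module.Projective B Q] (K : Submodule B Q)
    (hN : ∀ h : K →ₗ[B] N, ∃ h' : Q →ₗ[B] N, h' ∘ₗ K.subtype = h) :
    Subsingleton (Abelian.Ext.{u} (ModuleCat.of B (Q ⧸ K)) (ModuleCat.of B N) 1) :=
  subsingleton_ext_one K.injective_subtype
    (LinearMap.exact_iff.2 ((Submodule.ker_mkQ K).trans (Submodule.range_subtype K).symm))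
    (Submodule.mkQ_surjective K) hN

theorem hasProjectiveDimensionLE_one (hi : Function.Injective i) (he : Function.Exact i q)
    (hq : Function.Surjective q) [Module.Projective B K] [Module.Projective B Q] :
    HasProjectiveDimensionLE (ModuleCat.of B T) 1 := by
  let S : ShortComplex (ModuleCat.{u} B) := ShortComplex.mk (ModuleCat.ofHom i) (ModuleCat.ofHom q)
    (by ext x; exact he.apply_apply_eq_zero x)
  have hS : S.ShortExact := ModuleCat.shortComplex_shortExact S he hi hq
  have h1 : Projective (ModuleCat.of B K) := inferInstance
  have h2 : Projective (ModuleCat.of B Q) := inferInstance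
  exact hS.hasProjectiveDimensionLT_X₃ 1
    (inferInstanceAs (HasProjectiveDimensionLT (ModuleCat.of B K) 1))
    (inferInstanceAs (HasProjectiveDimensionLT (ModuleCat.of B Q) 2))

theorem InAdd.congr {N' : Type u} [AddCommGroup N'] [Module B N'] (h : InAdd B T N)
    (e : N' ≃ₗ[B] N) : InAdd B T N' :=
  (isSummand_of_linearEquiv e).trans_inAdd h

/-- A module `T` with a projective resolution `0 → K → Q → T → 0` is tilting as soon as every map
`K → T` extends to `Q` and there is an exact sequence `0 → B → T₀ → T₁ → 0` with terms
in `add T`. -/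
theorem isTiltingModule_of_exact (hi : Function.Injective i) (he : Function.Exact i q)
    (hq : Function.Surjective q) [Module.Finite B K] [Module.Finite B Q]
    [Module.Projective B K] [Module.Projective B Q]
    (hT : ∀ h : K →ₗ[B] T, ∃ h' : Q →ₗ[B] T, h' ∘ₗ i = h)
    {T₀ T₁ : Type u} [AddCommGroup T₀] [Module B T₀] [AddCommGroup T₁] [Module B T₁]
    (h₀ : InAdd B T T₀) (h₁ : InAdd B T T₁) {j : B →ₗ[B] T₀} {p : T₀ →ₗ[B] T₁}
    (hj : Function.Injective j) (hjp : Function.Exact j p) (hp : Function.Surjective p) :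
    IsTiltingModule B T where
  resolution := by
    let e : LinearMap.ker q ≃ₗ[B] K :=
      (LinearEquiv.ofEq _ _ (LinearMap.exact_iff.1 he)).trans (LinearEquiv.ofInjective i hi).symm
    refine ⟨1, ModuleCat.of B Q, q, ‹_›, ‹_›, hq, ?_, ?_⟩
    · exact Module.Finite.equiv e.symm
    · exact Module.Projective.of_equiv e.symm
  ext_eq_zero n hn := by
    rcases Nat.lt_or_ge 1 n with h | h
    · have := hasProjectiveDimensionLE_one hi he hq
      exact HasProjectiveDimensionLT.subsingleton (ModuleCat.of B T) 2 n h _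
    · obtain rfl : n = 1 := by omega
      exact subsingleton_ext_one hi he hq hT
  coresolution := by
    refine ⟨1, ModuleCat.of B T₀, j, h₀, hj, ?_⟩
    exact h₁.congr ((Submodule.quotEquivOfEq _ _ (LinearMap.exact_iff.1 hjp).symm).trans
      (p.quotKerEquivOfSurjective hp))

end Ext

/-! ### The functor `Hom(V, -)` on `add V`. -/

section HomMod

variable {A : Type u} [Ring A] {V X E N U W : Type u} [AddCommGroup V] [Module A V]
  [AddCommGroup X] [Module A X] [AddCommGroup E] [Module A E] [AddCommGroup N] [Module A N]
  [AddCommGroup U] [Module A U] [AddCommGroup W] [Module A W]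

theorem InAdd.exists_sum {T E : Type u} [AddCommGroup T] [Module A T] [AddCommGroup E] [Module A E]
    (h : InAdd A T E) : ∃ (n : ℕ) (p : Fin n → T →ₗ[A] E) (i : Fin n → E →ₗ[A] T),
      ∀ x, ∑ k, p k (i k x) = x := by
  obtain ⟨n, i, p, hpi⟩ := h
  refine ⟨n, fun k => p ∘ₗ LinearMap.single A (fun _ => T) k, fun k => LinearMap.proj k ∘ₗ i,
    fun x => ?_⟩
  have h2 := LinearMap.congr_fun hpi x
  have h3 : ∑ j, Pi.single j (i x j) = i x := by
    ext j; simp [Finset.sum_apply, Finset.sum_pi_single]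
  simp only [LinearMap.comp_apply, LinearMap.id_apply] at h2
  simp only [LinearMap.comp_apply, LinearMap.proj_apply, LinearMap.single_apply, ← map_sum, h3, h2]

namespace HomMod

/-- A linear map `V → X`, viewed as an element of `Hom_A(V, X)`. -/
def of (h : V →ₗ[A] X) : HomMod A V X := h

@[ext]
theorem ext {h k : HomMod A V X} (H : ∀ v, h.toLin v = k.toLin v) : h = k := LinearMap.ext H

@[simp]
theorem toLin_of (h : V →ₗ[A] X) : (of h).toLin = h := rfl

@[simp]
theorem toLin_add (h k : HomMod A V X) : (h + k).toLin = h.toLin + k.toLin := rfl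

@[simp]
theorem toLin_zero : (0 : HomMod A V X).toLin = 0 := rfl

@[simp]
theorem toLin_smul (b : (Module.End A V)ᵐᵒᵖ) (h : HomMod A V X) :
    (b • h).toLin = h.toLin ∘ₗ b.unop := rfl

@[simp]
theorem toLin_map (f : X →ₗ[A] E) (h : HomMod A V X) :
    (homModMap V f h).toLin = f ∘ₗ h.toLin := rfl

@[simp]
theorem toLin_sum {ι : Type*} (s : Finset ι) (h : ι → HomMod A V X) :
    (∑ k ∈ s, h k).toLin = ∑ k ∈ s, (h k).toLin :=
  map_sum (⟨⟨HomMod.toLin, rfl⟩, fun _ _ => rfl⟩ : HomMod A V X →+ (V →ₗ[A] X)) h s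

/-- The coordinates of elements of `Hom_A(V, E)` along maps `E → V`. -/
def coord (i : E →ₗ[A] V) : HomMod A V E →ₗ[(Module.End A V)ᵐᵒᵖ] (Module.End A V)ᵐᵒᵖ where
  toFun h := MulOpposite.op (i ∘ₗ h.toLin)
  map_add' h k := by
    rw [toLin_add, LinearMap.comp_add]; rfl
  map_smul' _ _ := rfl

@[simp]
theorem unop_coord (i : E →ₗ[A] V) (h : HomMod A V E) : (coord i h).unop = i ∘ₗ h.toLin := rfl

theorem exists_split (h : InAdd A V E) : ∃ (n : ℕ)
    (i : HomMod A V E →ₗ[(Module.End A V)ᵐᵒᵖ] (Fin n → (Module.End A V)ᵐᵒᵖ))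
    (p : (Fin n → (Module.End A V)ᵐᵒᵖ) →ₗ[(Module.End A V)ᵐᵒᵖ] HomMod A V E),
    p ∘ₗ i = LinearMap.id := by
  obtain ⟨n, p, i, hpi⟩ := h.exists_sum
  refine ⟨n, LinearMap.pi fun k => coord (i k), Fintype.linearCombination _ fun k => of (p k), ?_⟩
  ext h v
  simp [Fintype.linearCombination_apply, hpi]

theorem finite (h : InAdd A V E) : Module.Finite (Module.End A V)ᵐᵒᵖ (HomMod A V E) := by
  obtain ⟨n, i, p, hpi⟩ := exists_split h
  exact Module.Finite.of_surjective p fun x => ⟨i x, LinearMap.congr_fun hpi x⟩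

theorem projective (h : InAdd A V E) : Module.Projective (Module.End A V)ᵐᵒᵖ (HomMod A V E) := by
  obtain ⟨n, i, p, hpi⟩ := exists_split h
  exact Module.Projective.of_split i p hpi

/-- Fullness on `add V`: each element of `Hom(V, E)` is a `Λ`-combination of the finitely many maps
`p k : V → E`, so `θ` is determined by their images. -/
theorem exists_eq_map (h : InAdd A V E)
    (θ : HomMod A V E →ₗ[(Module.End A V)ᵐᵒᵖ] HomMod A V W) :
    ∃ b : E →ₗ[A] W, θ = homModMap V b := by
  obtain ⟨n, p, i, hpi⟩ := h.exists_sum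
  refine ⟨∑ k, (θ (of (p k))).toLin ∘ₗ i k, ?_⟩
  ext h v
  have : h = ∑ k, MulOpposite.op (i k ∘ₗ h.toLin) • of (p k) := by
    ext v
    simp [hpi]
  conv_lhs => rw [this]
  simp only [map_sum, map_smul]
  simp

theorem map_injective {k : X →ₗ[A] E} (hk : Function.Injective k) :
    Function.Injective (homModMap V k) := fun a b hab => by
  ext v
  exact hk (LinearMap.congr_fun (congrArg toLin hab) v)

theorem map_exact {k : X →ₗ[A] E} {q : E →ₗ[A] N} (hk : Function.Injective k)
    (h : Function.Exact k q) : Function.Exact (homModMap V k) (homModMap V q) := by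
  intro y
  constructor
  · intro hy
    obtain ⟨y', hy'⟩ := h.exists_lift hk y.toLin (congrArg toLin hy)
    exact ⟨of y', hy'⟩
  · rintro ⟨x, rfl⟩
    ext v
    exact h.apply_apply_eq_zero _

theorem eq_zero_of_forall_comp (h : InAdd A V E) {b : E →ₗ[A] W}
    (hb : ∀ a : V →ₗ[A] E, b ∘ₗ a = 0) : b = 0 := by
  obtain ⟨n, p, i, hpi⟩ := h.exists_sum
  ext x
  rw [← hpi x, map_sum]
  exact Finset.sum_eq_zero fun k _ => LinearMap.congr_fun (hb (p k)) (i k x)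

end HomMod

section EndRing

variable (V) (q : E →ₗ[A] N)

/-- If every map `E → N` factors through `q : E → N`, then endomorphisms of `N` act on the module
of all maps `V → N` that factor through `q`. -/
def endToEndRange (hR : ∀ h : E →ₗ[A] N, ∃ h' : E →ₗ[A] E, q ∘ₗ h' = h) :
    Module.End A N →+*
      Module.End (Module.End A V)ᵐᵒᵖ (LinearMap.range (homModMap V q)) where
  toFun c := (homModMap V c).restrict (by
    rintro _ ⟨h, rfl⟩
    obtain ⟨b, hb⟩ := hR (c ∘ₗ q)
    refine ⟨homModMap V b h, ?_⟩
    ext v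
    exact LinearMap.congr_fun hb (h.toLin v))
  map_one' := rfl
  map_mul' _ _ := rfl
  map_zero' := rfl
  map_add' _ _ := rfl

variable {V q}

/-- For surjectivity, an endomorphism of the image lifts to the projective module `Hom(V, E)`, where
it is induced by some `b : E → E`. Maps from `V` detect that `q ∘ b ∘ k = 0`, so `b` descends to
`N`. -/
theorem endToEndRange_bijective (hR : ∀ h : E →ₗ[A] N, ∃ h' : E →ₗ[A] E, q ∘ₗ h' = h)
    (hq : Function.Surjective q) (hE : InAdd A V E) {k : X →ₗ[A] E} (hX : InAdd A V X)
    (hk : Function.Exact k q) :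
    Function.Bijective (endToEndRange V q hR) := by
  constructor
  · rw [injective_iff_map_eq_zero]
    intro c hc
    have h1 : c ∘ₗ q = 0 := HomMod.eq_zero_of_forall_comp hE fun a => by
      have h2 := LinearMap.congr_fun hc ⟨homModMap V q (HomMod.of a), ⟨_, rfl⟩⟩
      exact congrArg (fun z => HomMod.toLin (Subtype.val z)) h2
    ext n
    obtain ⟨e, rfl⟩ := hq n
    exact LinearMap.congr_fun h1 e
  · intro θ
    have := HomMod.projective hE
    obtain ⟨β, hβ⟩ := Module.projective_lifting_property
      (homModMap V q).rangeRestrict (θ ∘ₗ (homModMap V q).rangeRestrict)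
      (LinearMap.surjective_rangeRestrict _)
    obtain ⟨b, rfl⟩ := HomMod.exists_eq_map hE β
    have h1 : (q ∘ₗ b) ∘ₗ k = 0 := HomMod.eq_zero_of_forall_comp hX fun a => by
      have h2 := LinearMap.congr_fun hβ (HomMod.of (k ∘ₗ a))
      have h3 : (homModMap V q).rangeRestrict (HomMod.of (k ∘ₗ a)) = 0 := by
        apply Subtype.ext
        ext v
        exact hk.apply_apply_eq_zero _
      rw [LinearMap.comp_apply, LinearMap.comp_apply, h3, map_zero] at h2
      exact congrArg (fun z => HomMod.toLin (Subtype.val z)) h2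
    obtain ⟨c, hc⟩ := hk.exists_desc hq _ h1
    refine ⟨c, ?_⟩
    ext ⟨_, ⟨h, rfl⟩⟩ v
    have h2 := congrArg (fun z => HomMod.toLin (Subtype.val z)) (LinearMap.congr_fun hβ h)
    exact (LinearMap.congr_fun hc (h.toLin v)).trans (LinearMap.congr_fun h2 v)

theorem nonempty_end_ringEquiv (hR : ∀ h : E →ₗ[A] N, ∃ h' : E →ₗ[A] E, q ∘ₗ h' = h)
    (hq : Function.Surjective q) (hE : InAdd A V E) {k : X →ₗ[A] E} (hX : InAdd A V X)
    (hki : Function.Injective k) (hk : Function.Exact k q) :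
    Nonempty (Module.End A N ≃+* Module.End (Module.End A V)ᵐᵒᵖ
      (HomMod A V E ⧸ LinearMap.range (homModMap V k))) := by
  let e : (HomMod A V E ⧸ LinearMap.range (homModMap V k)) ≃ₗ[(Module.End A V)ᵐᵒᵖ]
      LinearMap.range (homModMap V q) :=
    (Submodule.quotEquivOfEq _ _ (LinearMap.exact_iff.1 (HomMod.map_exact hki hk)).symm).trans
      (homModMap V q).quotKerEquivRange
  exact ⟨(RingEquiv.ofBijective _ (endToEndRange_bijective hR hq hE hX hk)).trans
    e.symm.conjRingEquiv⟩

end EndRing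

/-! ### The exchange module is tilting, with the expected endomorphism ring. -/

section Exchange

variable {M Y : Type u} [AddCommGroup M] [Module A M] [AddCommGroup Y] [Module A Y]

/-- The exchange module of `f : X → M` decomposes as `Coker Hom(V, f) ⊕ Hom(V, M)`. -/
noncomputable def exchangeEquiv (f : X →ₗ[A] M) : ExchangeModule M f ≃ₗ[(Module.End A (M × X))ᵐᵒᵖ]
    (HomMod A (M × X) M ⧸ LinearMap.range (homModMap (M × X) f)) × HomMod A (M × X) M :=
  let π : HomMod A (M × X) (M × M) →ₗ[(Module.End A (M × X))ᵐᵒᵖ]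
      (HomMod A (M × X) M ⧸ LinearMap.range (homModMap (M × X) f)) × HomMod A (M × X) M :=
    ((Submodule.mkQ _) ∘ₗ homModMap (M × X) (LinearMap.fst A M M)).prod
      (homModMap (M × X) (LinearMap.snd A M M))
  (Submodule.quotEquivOfEq _ (LinearMap.ker π) (by
    ext h
    constructor
    · rintro ⟨x, rfl⟩
      refine Prod.ext ((Submodule.Quotient.mk_eq_zero _).2 ⟨x, rfl⟩) rfl
    · intro hh
      obtain ⟨x, hx⟩ := (Submodule.Quotient.mk_eq_zero _).1 (congrArg Prod.fst hh)
      refine ⟨x, ?_⟩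
      ext v
      · exact LinearMap.congr_fun (congrArg HomMod.toLin hx) v
      · exact (LinearMap.congr_fun (congrArg HomMod.toLin (congrArg Prod.snd hh)) v).symm)).trans
    (π.quotKerEquivOfSurjective (by
      rintro ⟨a, b⟩
      obtain ⟨a, rfl⟩ := Submodule.mkQ_surjective _ a
      exact ⟨HomMod.of (a.toLin.prod b.toLin), rfl⟩))

/-- The resolution is `0 → Hom(V, X) → Hom(V, M ⊕ M) → T_f → 0`. The coresolution is `Hom(V, -)`
applied to `1 ⊕ f : M ⊕ X → M ⊕ M`, with cokernel `Coker Hom(V, f)`; the element `(fst, f ∘ snd)` is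
the image of `1`. -/
theorem isTiltingModule_exchange {f : X →ₗ[A] M} (hf : Function.Injective f)
    (hL : ∀ h : X →ₗ[A] M, ∃ h' : M →ₗ[A] M, h' ∘ₗ f = h) :
    IsTiltingModule (Module.End A (M × X))ᵐᵒᵖ (ExchangeModule M f) := by
  have hM : InAdd A (M × X) M := (isSummand_prod_left M X).inAdd
  have hX : InAdd A (M × X) X := (isSummand_prod_right M X).inAdd
  have := HomMod.finite hX
  have := HomMod.finite (hM.prod hM)
  have := HomMod.projective hX
  have := HomMod.projective (hM.prod hM)
  have hinj : Function.Injective (LinearMap.inl A M M ∘ₗ f) :=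
    LinearMap.inl_injective.comp hf
  refine isTiltingModule_of_exact (i := homModMap (M × X) (LinearMap.inl A M M ∘ₗ f))
    (q := Submodule.mkQ _) (HomMod.map_injective hinj)
    (LinearMap.exact_iff.2 (Submodule.ker_mkQ _)) (Submodule.mkQ_surjective _) ?_
    (T₀ := HomMod A (M × X) M × HomMod A (M × X) M)
    (T₁ := HomMod A (M × X) M ⧸ LinearMap.range (homModMap (M × X) f))
    (j := LinearMap.toSpanSingleton _ _ (HomMod.of (LinearMap.fst A M X),
        HomMod.of (f ∘ₗ LinearMap.snd A M X)))
    (p := Submodule.mkQ _ ∘ₗ LinearMap.snd _ _ _) ?_ ?_ ?_ ?_ ?_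
  -- By projectivity the map comes from some `b : X → M ⊕ M`, whose two components extend along `f`.
  · intro h
    obtain ⟨β, hβ⟩ := Module.projective_lifting_property (Submodule.mkQ _) h
      (Submodule.mkQ_surjective _)
    obtain ⟨b, rfl⟩ := HomMod.exists_eq_map hX β
    obtain ⟨b₁, hb₁⟩ := hL (LinearMap.fst A M M ∘ₗ b)
    obtain ⟨b₂, hb₂⟩ := hL (LinearMap.snd A M M ∘ₗ b)
    refine ⟨Submodule.mkQ _ ∘ₗ homModMap (M × X) ((b₁.prod b₂) ∘ₗ LinearMap.fst A M M), ?_⟩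
    rw [← hβ, LinearMap.comp_assoc]
    congr 1
    ext h v
    · exact LinearMap.congr_fun hb₁ (h.toLin v)
    · exact LinearMap.congr_fun hb₂ (h.toLin v)
  · have h1 : IsSummand (Module.End A (M × X))ᵐᵒᵖ (HomMod A (M × X) M) (ExchangeModule M f) := by
      refine ⟨(exchangeEquiv f).symm.toLinearMap ∘ₗ LinearMap.inr _ _ _,
        LinearMap.snd _ _ _ ∘ₗ (exchangeEquiv f).toLinearMap, ?_⟩
      ext h v
      simp
    exact h1.inAdd.prod h1.inAdd
  · refine IsSummand.inAdd ⟨(exchangeEquiv f).symm.toLinearMap ∘ₗ LinearMap.inl _ _ _,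
        LinearMap.fst _ _ _ ∘ₗ (exchangeEquiv f).toLinearMap, ?_⟩
    ext h
    simp
  · rw [injective_iff_map_eq_zero]
    intro b hb
    have h1 := fun v => LinearMap.congr_fun (congrArg (fun z => HomMod.toLin z.1) hb) v
    have h2 := fun v => LinearMap.congr_fun (congrArg (fun z => HomMod.toLin z.2) hb) v
    apply MulOpposite.unop_injective
    refine LinearMap.ext fun v => Prod.ext (h1 v) (hf ?_)
    exact (h2 v).trans (map_zero f).symm
  · rintro ⟨a, b⟩
    constructor
    · intro h
      obtain ⟨x, hx⟩ := (Submodule.Quotient.mk_eq_zero _).1 h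
      exact ⟨MulOpposite.op (a.toLin.prod x.toLin), Prod.ext rfl hx⟩
    · rintro ⟨c, hc⟩
      refine (Submodule.Quotient.mk_eq_zero _).2 ⟨HomMod.of (LinearMap.snd A M X ∘ₗ c.unop), ?_⟩
      exact congrArg Prod.snd hc
  · exact (Submodule.mkQ_surjective _).comp LinearMap.snd_surjective

theorem derivedEquivalentVia_exchange {f : X →ₗ[A] M} {g : M →ₗ[A] Y} (hf : Function.Injective f)
    (hfg : Function.Exact f g) (hg : Function.Surjective g)
    (hL : ∀ h : X →ₗ[A] M, ∃ h' : M →ₗ[A] M, h' ∘ₗ f = h)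
    (hR : ∀ h : M →ₗ[A] Y, ∃ h' : M →ₗ[A] M, g ∘ₗ h' = h) :
    DerivedEquivalentVia (Module.End A (M × X))ᵐᵒᵖ (Module.End A (M × Y))ᵐᵒᵖ
      (ExchangeModule M f) := by
  refine ⟨isTiltingModule_exchange hf hL, ?_⟩
  have hM : InAdd A (M × X) M := (isSummand_prod_left M X).inAdd
  have hX : InAdd A (M × X) X := (isSummand_prod_right M X).inAdd
  -- The sequence used is `X → M ⊕ M → Y ⊕ M`, with the identity on the second copy of `M`.
  obtain ⟨e⟩ := nonempty_end_ringEquiv (V := M × X) (k := LinearMap.inl A M M ∘ₗ f)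
    (q := g.prodMap (LinearMap.id : M →ₗ[A] M)) (fun h => by
      obtain ⟨h₁, hh₁⟩ := hR (LinearMap.fst A Y M ∘ₗ h ∘ₗ LinearMap.inl A M M)
      obtain ⟨h₂, hh₂⟩ := hR (LinearMap.fst A Y M ∘ₗ h ∘ₗ LinearMap.inr A M M)
      refine ⟨(h₁.coprod h₂).prod (LinearMap.snd A Y M ∘ₗ h), ?_⟩
      ext x
      · simpa using LinearMap.congr_fun hh₁ x
      · simp
      · simpa using LinearMap.congr_fun hh₂ x
      · simp) (Function.Surjective.prodMap hg Function.surjective_id) (hM.prod hM) hX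
    (LinearMap.inl_injective.comp hf) (by
      rintro ⟨a, b⟩
      constructor
      · intro h
        obtain ⟨x, hx⟩ := (hfg a).1 (congrArg Prod.fst h)
        exact ⟨x, Prod.ext hx (congrArg Prod.snd h).symm⟩
      · rintro ⟨x, hx⟩
        obtain ⟨rfl, rfl⟩ := Prod.mk.inj hx
        exact Prod.ext (hfg.apply_apply_eq_zero x) rfl)
  exact ⟨RingEquiv.op ((LinearEquiv.prodComm A M Y).conjRingEquiv.trans e)⟩

end Exchange

end HomMod

/-! ### The socle of the injective envelope of `R / rad R`. -/

section InjectiveEnvelope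

variable {R J : Type u} [CommRing R] [IsArtinianRing R] [AddCommGroup J] [Module R J]

/-- The elements of `J` killed by `m` form a line over `R / m`: by essentiality they lie in `R / rad
R`, where `R / m` occurs exactly once. -/
theorem IsInjectiveEnvelopeOfTop.exists_socle_generator (hJ : IsInjectiveEnvelopeOfTop R J)
    (m : Ideal R) [hm : m.IsMaximal] :
    ∃ x : J, x ≠ 0 ∧ (∀ r ∈ m, r • x = 0) ∧
      ∀ y : J, (∀ r ∈ m, r • y = 0) → ∃ r : R, y = r • x := by
  obtain ⟨-, ι, hι, hess⟩ := hJ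
  have hred : ∀ c : R, c * c ∈ Ring.jacobson R → c ∈ Ring.jacobson R := by
    intro c hc
    rw [Ring.jacobson_eq_sInf_isMaximal, Ideal.mem_sInf] at hc ⊢
    intro I hI
    exact (or_self_iff).1 ((Ideal.IsMaximal.isPrime hI).mem_or_mem (hc hI))
  -- Some nonzero multiple `a • y` lies in the image of `ι`; then `a ∉ m`, and an inverse of `a`
  -- modulo `m` recovers `y`.
  have hsoc : ∀ y : J, (∀ r ∈ m, r • y = 0) →
      ∃ c : R, (∀ r ∈ m, r * c ∈ Ring.jacobson R) ∧ ι (Ideal.Quotient.mk _ c) = y := by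
    intro y hy
    by_cases hy0 : y = 0
    · exact ⟨0, by simp, by simp [hy0]⟩
    have h1 : R ∙ y ⊓ LinearMap.range ι ≠ ⊥ := fun h => by
      have := hess _ h
      exact hy0 (Submodule.span_singleton_eq_bot.1 this)
    obtain ⟨z, ⟨hz1, z', hz'⟩, hz0⟩ := Submodule.exists_mem_ne_zero_of_ne_bot h1
    obtain ⟨a, rfl⟩ := Submodule.mem_span_singleton.1 hz1
    have ha : a ∉ m := fun h => hz0 (hy a h)
    obtain ⟨b, i, hi, hb⟩ := Ideal.IsMaximal.exists_inv hm ha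
    obtain ⟨c, rfl⟩ := Ideal.Quotient.mk_surjective z'
    have hc : ι (Ideal.Quotient.mk _ (b * c)) = y := by
      have h2 : (Ideal.Quotient.mk (Ring.jacobson R) (b * c)) = b • Ideal.Quotient.mk _ c := rfl
      rw [h2, map_smul, hz', smul_smul, ← sub_eq_zero]
      have : b * a = 1 - i := by rw [← hb]; ring
      rw [this, sub_smul, hy i hi]
      simp
    refine ⟨b * c, fun r hr => ?_, hc⟩
    rw [← Ideal.Quotient.eq_zero_iff_mem]
    apply hι
    have h2 : (Ideal.Quotient.mk (Ring.jacobson R) (r * (b * c)))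
      = r • Ideal.Quotient.mk _ (b * c) := rfl
    rw [h2, map_smul, hc, hy r hr, map_zero]
  -- If there were no such `c`, the product of the other maximal ideals would lie in `m`, and then
  -- one of them would equal `m`.
  obtain ⟨c, hcm, hc⟩ : ∃ c : R, c ∉ m ∧ ∀ r ∈ m, r * c ∈ Ring.jacobson R := by
    have : Fintype (MaximalSpectrum R) := Fintype.ofFinite _
    classical
    by_contra! hcon
    have hle : ∏ I ∈ Finset.univ.erase (⟨m, hm⟩ : MaximalSpectrum R), I.asIdeal ≤ m := by
      intro c hc
      by_contra hcm
      obtain ⟨r, hr, hrc⟩ := hcon c hcm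
      apply hrc
      rw [Ring.jacobson_eq_sInf_isMaximal, Ideal.mem_sInf]
      intro I hI
      by_cases h : I = m
      · exact I.mul_mem_right _ (h.symm ▸ hr)
      · refine I.mul_mem_left _ (Ideal.prod_le_inf.trans (Finset.inf_le (b := ⟨I, hI⟩) ?_) hc)
        simpa using h
    obtain ⟨I, hI, hIm⟩ := (Ideal.IsPrime.prod_le hm.isPrime).1 hle
    have := I.isMaximal.eq_of_le hm.ne_top hIm
    exact (Finset.mem_erase.1 hI).1 (MaximalSpectrum.ext this)
  refine ⟨ι (Ideal.Quotient.mk _ c), ?_, ?_, ?_⟩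
  · intro h
    have : Ideal.Quotient.mk (Ring.jacobson R) c = 0 := hι (h.trans (map_zero ι).symm)
    exact hcm (Ring.jacobson_le_of_isMaximal m (Ideal.Quotient.eq_zero_iff_mem.1 this))
  · intro r hr
    have h2 : r • Ideal.Quotient.mk (Ring.jacobson R) c = Ideal.Quotient.mk _ (r * c) := rfl
    rw [← map_smul, h2, Ideal.Quotient.eq_zero_iff_mem.2 (hc r hr), map_zero]
  · intro y hy
    obtain ⟨c', hc', rfl⟩ := hsoc y hy
    obtain ⟨b, i, hi, hb⟩ := Ideal.IsMaximal.exists_inv hm hcm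
    refine ⟨c' * b, ?_⟩
    rw [← map_smul]
    congr 1
    change _ = Ideal.Quotient.mk (Ring.jacobson R) (c' * b * c)
    rw [Ideal.Quotient.eq]
    have : c' - c' * b * c = i * c' := by
      rw [show i = 1 - b * c by rw [← hb]; ring]; ring
    rw [this]
    exact hc' i hi

end InjectiveEnvelope

/-! ### The dual of a simple module. -/

section ArtinDual

variable {R B J : Type u} [CommRing R] [Ring B] [Algebra R B] [AddCommGroup J]
  [Module R J] {S : Type u} [AddCommGroup S] [Module B S]

/-- The value of a functional in `D(S)`. -/
def ArtinDual.eval (φ : ArtinDual R B J S) : S →+ J :=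
  φ.toLin.toAddMonoidHom.comp (RestrictScalars.addEquiv R B S).symm.toAddMonoidHom

theorem ArtinDual.ext {φ ψ : ArtinDual R B J S} (h : ∀ s, φ.eval s = ψ.eval s) : φ = ψ :=
  LinearMap.ext h

theorem ArtinDual.eval_smul (b : Bᵐᵒᵖ) (φ : ArtinDual R B J S) (s : S) :
    (b • φ).eval s = φ.eval (b.unop • s) := rfl

theorem ArtinDual.eval_algebraMap_smul (r : R) (φ : ArtinDual R B J S) (s : S) :
    φ.eval (algebraMap R B r • s) = r • φ.eval s :=
  φ.toLin.map_smul r _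

theorem ArtinDual.eval_zero (s : S) : (0 : ArtinDual R B J S).eval s = 0 := rfl

/-- The functional in `D(S)` given by an `R`-linear map, for the `R`-module structure on `S` that
is induced by the `B`-module structure. -/
def ArtinDual.mk [Module R S] [IsScalarTower R B S] (φ : S →ₗ[R] J) : ArtinDual R B J S :=
  { toFun := φ
    map_add' := φ.map_add
    map_smul' := fun r s =>
      (congrArg φ (algebraMap_smul B r (RestrictScalars.addEquiv R B S s))).trans
        (φ.map_smul r s) :
      RestrictScalars R B S →ₗ[R] J }

/-- An element of `D(S)` as a linear map out of `S`. -/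
def ArtinDual.linear [Module R S] [IsScalarTower R B S] (φ : ArtinDual R B J S) : S →ₗ[R] J where
  toFun := φ.eval
  map_add' := map_add _
  map_smul' r s := by
    rw [← ArtinDual.eval_algebraMap_smul, algebraMap_smul]
    rfl

theorem IsSimpleModule.mem_of_mem [IsSimpleModule B S] (L : Submodule B S) {x : S} (hx : x ∈ L)
    (hx0 : x ≠ 0) (y : S) : y ∈ L := by
  rcases eq_bot_or_eq_top L with h | h
  · rw [h] at hx
    exact absurd hx hx0
  · rw [h]
    trivial

variable [IsArtinianRing R]

/-- By simplicity the annihilator of `S` in `R` is prime, and primes of an Artinian ring are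
maximal. -/
theorem exists_maximal_annihilating (R : Type u) {B : Type u} [CommRing R] [IsArtinianRing R]
    [Ring B] [Algebra R B] (S : Type u) [AddCommGroup S]
    [Module B S] [IsSimpleModule B S] :
    ∃ m : Ideal R, m.IsMaximal ∧ ∀ r ∈ m, ∀ s : S, algebraMap R B r • s = 0 := by
  let m : Ideal R :=
    { carrier := {r | ∀ s : S, algebraMap R B r • s = 0}
      add_mem' := fun ha hb s => by rw [map_add, add_smul, ha, hb, add_zero]
      zero_mem' := fun s => by simp
      smul_mem' := fun c x hx s => by rw [smul_eq_mul, map_mul, mul_smul, hx, smul_zero] }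
  have hprime : m.IsPrime := by
    refine ⟨fun h => ?_, fun {a b} hab => ?_⟩
    · have := IsSimpleModule.nontrivial B S
      obtain ⟨s, hs⟩ := exists_ne (0 : S)
      have h1 : (1 : R) ∈ m := h ▸ trivial
      exact hs (by simpa using h1 s)
    · by_contra! hcon
      obtain ⟨s, hs⟩ : ∃ s : S, algebraMap R B b • s ≠ 0 := by
        by_contra! h
        exact hcon.2 h
      apply hcon.1
      let L : Submodule B S :=
        { carrier := {x | algebraMap R B a • x = 0}
          add_mem' := fun {x y} hx hy => by
            change _ • (x + y) = 0
            rw [smul_add, hx, hy, add_zero]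
          zero_mem' := smul_zero _
          smul_mem' := fun c x hx => by
            change algebraMap R B a • c • x = 0
            rw [smul_smul, Algebra.commutes, mul_smul, show algebraMap R B a • x = 0 from hx,
              smul_zero] }
      refine fun y => IsSimpleModule.mem_of_mem L (x := algebraMap R B b • s) ?_ hs y
      change algebraMap R B a • algebraMap R B b • s = 0
      rw [smul_smul, ← map_mul]
      exact hab s
  exact ⟨m, inferInstance, fun r hr => hr⟩

/-- For `s ≠ 0` the submodule `R s` is `R / m`; it maps to a nonzero socle element of `J`, and the
map extends by injectivity. -/
theorem exists_artinDual_ne_zero (hJ : IsInjectiveEnvelopeOfTop R J) [IsSimpleModule B S] :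
    ∃ φ : ArtinDual R B J S, φ ≠ 0 := by
  obtain ⟨m, hm, hmS⟩ := exists_maximal_annihilating R (B := B) S
  obtain ⟨x, hx0, hxm, -⟩ := hJ.exists_socle_generator m
  have := IsSimpleModule.nontrivial B S
  obtain ⟨s, hs⟩ := exists_ne (0 : S)
  let _ : Module R S := Module.compHom S (algebraMap R B)
  have : IsScalarTower R B S := IsScalarTower.of_algebraMap_smul fun _ _ => rfl
  let F := LinearMap.toSpanSingleton R S s
  have hF : m ≤ LinearMap.ker F := fun r hr => hmS r hr s
  have hF' : LinearMap.ker F ≤ m := by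
    refine (hm.eq_of_le (fun h => hs ?_) hF).ge
    have h1 : F 1 = 0 := LinearMap.mem_ker.1 (h ▸ trivial)
    exact (one_smul R s).symm.trans h1
  obtain ⟨φ, hφ⟩ := hJ.1.out (m.liftQ F hF)
    (LinearMap.ker_eq_bot.1 (Submodule.ker_liftQ_eq_bot _ _ _ hF'))
    (m.liftQ (LinearMap.toSpanSingleton R J x) (fun r hr => hxm r hr))
  refine ⟨ArtinDual.mk φ, fun h0 => hx0 ?_⟩
  have h1 : φ ((1 : R) • s) = (1 : R) • x := hφ (Submodule.Quotient.mk 1)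
  rw [one_smul, one_smul] at h1
  rw [← h1]
  exact congrArg (fun ψ : ArtinDual R B J S => ψ.eval s) h0

/-- Finitely many translates of `φ₀` embed `S` in a power of `J`, and `φ` extends to that power. On
the part of each coordinate killed by `m`, which is a line, the extension is multiplication by a
scalar, so `φ` is a combination of the translates. -/
theorem exists_smul_eq_artinDual (hJ : IsInjectiveEnvelopeOfTop R J) [IsSimpleModule B S]
    [Module.Finite R B] {φ₀ : ArtinDual R B J S} (h₀ : φ₀ ≠ 0) (φ : ArtinDual R B J S) :
    ∃ b : B, φ = MulOpposite.op b • φ₀ := by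
  obtain ⟨m, hm, hmS⟩ := exists_maximal_annihilating R (B := B) S
  obtain ⟨x, hx0, hxm, hxg⟩ := hJ.exists_socle_generator m
  let _ : Module R S := Module.compHom S (algebraMap R B)
  have : IsScalarTower R B S := IsScalarTower.of_algebraMap_smul fun _ _ => rfl
  have : Module.Finite R S := Module.Finite.trans B S
  classical
  have hval : ∀ (ψ : ArtinDual R B J S) (s : S), ∀ r ∈ m, r • ψ.eval s = 0 := by
    intro ψ s r hr
    rw [← ArtinDual.eval_algebraMap_smul, hmS r hr, map_zero]
  let K : Finset B → Submodule R S := fun t =>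
    ⨅ b ∈ t, LinearMap.ker (MulOpposite.op b • φ₀).linear
  have hK : ∀ t (s : S), s ∈ K t ↔ ∀ b ∈ t, φ₀.eval (b • s) = 0 := by
    intro t s
    simp only [K, Submodule.mem_iInf]
    exact Iff.rfl
  -- A minimal common kernel of finitely many translates is zero: at a nonzero `s` in it some
  -- further translate is nonzero, since the elements on which all translates vanish form a proper
  -- submodule of `S`.
  obtain ⟨_, ⟨t, rfl⟩, hmin⟩ := IsArtinian.set_has_minimal (Set.range K) ⟨_, ∅, rfl⟩
  have hbot : ∀ s : S, s ∈ K t → s = 0 := by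
    intro s hs
    by_contra hs0
    obtain ⟨b, hb⟩ : ∃ b : B, φ₀.eval (b • s) ≠ 0 := by
      by_contra! hcon
      let L : Submodule B S :=
        { carrier := {y | ∀ b : B, φ₀.eval (b • y) = 0}
          add_mem' := fun hx hy b => by rw [smul_add, map_add, hx, hy, add_zero]
          zero_mem' := fun b => by rw [smul_zero, map_zero]
          smul_mem' := fun c y hy b => by rw [smul_smul]; exact hy _ }
      apply h₀
      apply ArtinDual.ext
      intro y
      have := IsSimpleModule.mem_of_mem L (x := s) hcon hs0 y 1
      rwa [one_smul] at this
    refine hmin (K (insert b t)) ⟨_, rfl⟩ (lt_of_le_of_ne ?_ fun h => ?_)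
    · intro y hy
      rw [hK] at hy ⊢
      exact fun c hc => hy c (Finset.mem_insert_of_mem hc)
    · rw [← h, hK] at hs
      exact hb (hs b (Finset.mem_insert_self b t))
  let F : S →ₗ[R] (t → J) :=
    LinearMap.pi fun b => (MulOpposite.op b.1 • φ₀).linear
  have hF : Function.Injective F := by
    rw [injective_iff_map_eq_zero]
    intro s hs
    refine hbot s ((hK t s).2 fun b hb => ?_)
    exact congrFun hs ⟨b, hb⟩
  obtain ⟨H, hH⟩ := hJ.1.out F hF φ.linear
  have hcoef : ∀ b : t, ∃ r : R, ∀ y : J, (∀ r ∈ m, r • y = 0) →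
      H (Pi.single b y) = r • y := by
    intro b
    obtain ⟨r, hr⟩ := hxg (H (Pi.single b x)) (fun c hc => by
      rw [← map_smul, ← Pi.single_smul, hxm c hc, Pi.single_zero, map_zero])
    refine ⟨r, fun y hy => ?_⟩
    obtain ⟨a, rfl⟩ := hxg y hy
    rw [Pi.single_smul, map_smul, hr, smul_comm]
  choose r hr using hcoef
  refine ⟨∑ b : t, algebraMap R B (r b) * b.1, ArtinDual.ext fun s => ?_⟩
  rw [ArtinDual.eval_smul, MulOpposite.unop_op, Finset.sum_smul, map_sum]
  have h1 : φ.eval s = H (F s) := (hH s).symm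
  have h2 : F s = ∑ b, Pi.single b (F s b) := by
    ext j; simp [Finset.sum_apply, Finset.sum_pi_single]
  rw [h1, h2, map_sum]
  refine Finset.sum_congr rfl fun b _ => ?_
  have h3 : F s b = φ₀.eval (b.1 • s) := rfl
  rw [h3, hr b _ (hval _ _), mul_smul, ArtinDual.eval_algebraMap_smul]

end ArtinDual

/-! ### Right modules `Hom(U, V)` over `End(V)` and their duals. -/

section CoHom

/-- The abelian group `Hom_A(U, V)`, made into a right module over the endomorphism ring of `V`
below. -/
def CoHom (A : Type u) [Ring A] (V U : Type u) [AddCommGroup V] [Module A V]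
    [AddCommGroup U] [Module A U] : Type u := U →ₗ[A] V

variable {A : Type u} [Ring A] {V U W : Type u} [AddCommGroup V] [Module A V]
  [AddCommGroup U] [Module A U] [AddCommGroup W] [Module A W]

instance : AddCommGroup (CoHom A V U) := inferInstanceAs (AddCommGroup (U →ₗ[A] V))

/-- An element of `Hom_A(U, V)`, viewed as a linear map. -/
def CoHom.toLin (h : CoHom A V U) : U →ₗ[A] V := h

/-- A linear map `U → V`, viewed as an element of `Hom_A(U, V)`. -/
def CoHom.of (h : U →ₗ[A] V) : CoHom A V U := h

instance : Module (Module.End A V)ᵐᵒᵖᵐᵒᵖ (CoHom A V U) where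
  smul b h := (b.unop.unop ∘ₗ h.toLin : U →ₗ[A] V)
  one_smul _ := rfl
  mul_smul _ _ _ := rfl
  smul_zero b := LinearMap.comp_zero b.unop.unop
  smul_add b h k := LinearMap.comp_add h.toLin k.toLin b.unop.unop
  add_smul _ _ _ := rfl
  zero_smul _ := rfl

namespace CoHom

@[ext]
theorem ext {h k : CoHom A V U} (H : ∀ v, h.toLin v = k.toLin v) : h = k := LinearMap.ext H

/-- The homomorphism `Hom_A(W, V) → Hom_A(U, V)` induced by `f : U → W`. -/
def comap (V : Type u) [AddCommGroup V] [Module A V] (f : U →ₗ[A] W) :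
    CoHom A V W →ₗ[(Module.End A V)ᵐᵒᵖᵐᵒᵖ] CoHom A V U where
  toFun h := of (h.toLin ∘ₗ f)
  map_add' _ _ := rfl
  map_smul' _ _ := rfl

/-- The endomorphism of `V` obtained by extending a map `U → V` along `p : V → U`. -/
def extend (p : V →ₗ[A] U) :
    CoHom A V U →ₗ[(Module.End A V)ᵐᵒᵖᵐᵒᵖ] (Module.End A V)ᵐᵒᵖᵐᵒᵖ where
  toFun h := MulOpposite.op (MulOpposite.op (h.toLin ∘ₗ p))
  map_add' _ _ := rfl
  map_smul' _ _ := rfl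

section Retract

variable {j : U →ₗ[A] V} {p : V →ₗ[A] U}

theorem extend_smul (hjp : p ∘ₗ j = LinearMap.id) (h : CoHom A V U) :
    extend p h • of j = h := by
  ext v
  exact congrArg h.toLin (LinearMap.congr_fun hjp v)

theorem toSpanSingleton_comp_extend (hjp : p ∘ₗ j = LinearMap.id) :
    LinearMap.toSpanSingleton (Module.End A V)ᵐᵒᵖᵐᵒᵖ (CoHom A V U) (of j) ∘ₗ extend p =
      LinearMap.id :=
  LinearMap.ext fun h => extend_smul hjp h

theorem finite (hjp : p ∘ₗ j = LinearMap.id) :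
    Module.Finite (Module.End A V)ᵐᵒᵖᵐᵒᵖ (CoHom A V U) :=
  Module.Finite.of_surjective
    (LinearMap.toSpanSingleton (Module.End A V)ᵐᵒᵖᵐᵒᵖ (CoHom A V U) (of j))
    fun h => ⟨extend p h, extend_smul hjp h⟩

theorem projective (hjp : p ∘ₗ j = LinearMap.id) :
    Module.Projective (Module.End A V)ᵐᵒᵖᵐᵒᵖ (CoHom A V U) :=
  Module.Projective.of_split _ _ (toSpanSingleton_comp_extend hjp)

/-- The `End(V)`-dual of `Hom_A(U, V)` is `Hom_A(V, U)` when `U` is a direct summand of `V`. -/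
def dualEquiv (hjp : p ∘ₗ j = LinearMap.id) : HomMod A V U ≃ₗ[(Module.End A V)ᵐᵒᵖ]
    (CoHom A V U →ₗ[(Module.End A V)ᵐᵒᵖᵐᵒᵖ] (Module.End A V)ᵐᵒᵖ) where
  toFun h :=
    { toFun := fun k => MulOpposite.op (k.toLin ∘ₗ h.toLin)
      map_add' := fun _ _ => rfl
      map_smul' := fun _ _ => rfl }
  map_add' h k := by
    ext x : 1
    exact congrArg MulOpposite.op (LinearMap.comp_add h.toLin k.toLin x.toLin)
  map_smul' _ _ := rfl
  invFun φ := HomMod.of (p ∘ₗ (φ (of j)).unop)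
  left_inv h := by
    ext v
    exact LinearMap.congr_fun hjp _
  right_inv φ := by
    ext k : 1
    conv_rhs => rw [← extend_smul hjp k, map_smul]
    rfl

theorem dualMapRight_comap {j' : W →ₗ[A] V} {p' : V →ₗ[A] W} (hjp : p ∘ₗ j = LinearMap.id)
    (hjp' : p' ∘ₗ j' = LinearMap.id) (f : U →ₗ[A] W) (h : HomMod A V U) :
    dualEquiv hjp' (homModMap V f h) = dualMapRight (comap V f) (dualEquiv hjp h) := rfl

/-- `Hom(U, V)` is generated by `j`. If `j = k + l` with `k ∈ K` and `l ∈ L`, then `p ∘ l = 1 - p ∘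
k` is invertible, so `l` is again a generator. -/
theorem isSuperfluous (hjp : p ∘ₗ j = LinearMap.id)
    {K : Submodule (Module.End A V)ᵐᵒᵖᵐᵒᵖ (CoHom A V U)}
    (hK : ∀ k ∈ K, IsNilpotent (p ∘ₗ k.toLin : Module.End A U)) : IsSuperfluous K := by
  intro L hL
  have hj : of j ∈ K ⊔ L := hL ▸ Submodule.mem_top
  obtain ⟨k, hk, l, hl, hkl⟩ := Submodule.mem_sup.1 hj
  have h1 : (p ∘ₗ l.toLin : Module.End A U) = 1 - p ∘ₗ k.toLin := by
    have h2 : p ∘ₗ (of j).toLin = p ∘ₗ k.toLin + p ∘ₗ l.toLin := by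
      rw [← hkl]
      exact LinearMap.comp_add k.toLin l.toLin p
    rw [eq_sub_iff_add_eq', ← h2]
    exact hjp
  obtain ⟨s, hs⟩ := (h1 ▸ (hK k hk).isUnit_one_sub :
    IsUnit (p ∘ₗ l.toLin : Module.End A U)).exists_left_inverse
  rw [eq_top_iff]
  intro h _
  have : h = (MulOpposite.op (MulOpposite.op (h.toLin ∘ₗ s ∘ₗ p)) :
      (Module.End A V)ᵐᵒᵖᵐᵒᵖ) • l := by
    ext v
    exact congrArg h.toLin (LinearMap.congr_fun hs v).symm
  rw [this]
  exact L.smul_mem _ hl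

end Retract

end CoHom

end CoHom

/-! ### The radical and the simple top of `Hom(V, X)`. -/

section Radical

variable {A : Type u} [Ring A] {X : Type u} [AddCommGroup X] [Module A X]

theorem IsNilpotent.not_comp_eq_id [Nontrivial X] {t s : Module.End A X} (ht : IsNilpotent t) :
    ¬ s * t = 1 := by
  intro h
  obtain ⟨n, hn⟩ := ht
  have key : ∀ n : ℕ, s ^ n * t ^ n = 1 := by
    intro n
    induction n with
    | zero => simp
    | succ n ih => rw [_root_.pow_succ, _root_.pow_succ', mul_assoc, ← mul_assoc s, h, one_mul, ih]
  have h2 := key n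
  rw [hn, mul_zero] at h2
  exact zero_ne_one h2

theorem IsIndecomposableModule.isNilpotent_add [IsArtinian A X] [IsNoetherian A X]
    (hX : IsIndecomposableModule A X) {a b : Module.End A X} (ha : IsNilpotent a)
    (hb : IsNilpotent b) : IsNilpotent (a + b) := by
  have := hX.1
  refine (hX.isUnit_or_isNilpotent _).resolve_left fun ⟨u, hu⟩ => ?_
  have h1 : (↑u⁻¹ * a) + (↑u⁻¹ * b) = 1 := by
    rw [← mul_add, ← hu, Units.inv_mul]
  rcases hX.isUnit_or_isUnit h1 with h | h
  · rw [Units.isUnit_units_mul] at h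
    obtain ⟨s, hs⟩ := h.exists_left_inv
    exact ha.not_comp_eq_id hs
  · rw [Units.isUnit_units_mul] at h
    obtain ⟨s, hs⟩ := h.exists_left_inv
    exact hb.not_comp_eq_id hs

variable (V : Type u) [AddCommGroup V] [Module A V] [IsArtinian A X] [IsNoetherian A X]

/-- The radical maps `V → X` for an indecomposable module `X` of finite length, that is, the maps
which are not split epimorphisms. -/
def radHom (hX : IsIndecomposableModule A X) :
    Submodule (Module.End A V)ᵐᵒᵖ (HomMod A V X) where
  carrier := {h | ∀ k : X →ₗ[A] V, IsNilpotent (h.toLin ∘ₗ k : Module.End A X)}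
  add_mem' := fun ha hb k => hX.isNilpotent_add (ha k) (hb k)
  zero_mem' := fun k => by
    rw [HomMod.toLin_zero, LinearMap.zero_comp]
    exact IsNilpotent.zero
  smul_mem' := fun b _ hh k => hh (b.unop ∘ₗ k)

variable {V}

theorem mem_radHom {hX : IsIndecomposableModule A X} {h : HomMod A V X} :
    h ∈ radHom V hX ↔ ∀ k : X →ₗ[A] V, IsNilpotent (h.toLin ∘ₗ k : Module.End A X) := Iff.rfl

/-- A map `V → X` outside the radical is a split epimorphism, so every map `V → X` factors through
it. Simplicity of the top and superfluity of the radical both follow. -/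
theorem eq_top_of_not_mem_radHom (hX : IsIndecomposableModule A X)
    {L : Submodule (Module.End A V)ᵐᵒᵖ (HomMod A V X)} {h : HomMod A V X} (hL : h ∈ L)
    (hh : h ∉ radHom V hX) : L = ⊤ := by
  rw [mem_radHom] at hh
  push Not at hh
  obtain ⟨k, hk⟩ := hh
  obtain ⟨s, hs⟩ := ((hX.isUnit_or_isNilpotent _).resolve_right hk).exists_right_inverse
  rw [eq_top_iff]
  intro h' _
  have : h' = (MulOpposite.op (k ∘ₗ s ∘ₗ h'.toLin) : (Module.End A V)ᵐᵒᵖ) • h := by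
    ext v
    exact (LinearMap.congr_fun hs (h'.toLin v)).symm
  rw [this]
  exact L.smul_mem _ hL

theorem radHom_ne_top (hX : IsIndecomposableModule A X) (hV : IsSummand A X V) :
    radHom V hX ≠ ⊤ := by
  obtain ⟨i, p, hpi⟩ := hV
  intro h
  have h1 : HomMod.of p ∈ radHom V hX := h ▸ Submodule.mem_top
  have := hX.1
  have h2 := h1 i
  rw [HomMod.toLin_of, hpi] at h2
  exact h2.not_comp_eq_id (s := 1) (one_mul _)

theorem isSuperfluous_radHom (hX : IsIndecomposableModule A X) (hV : IsSummand A X V) :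
    IsSuperfluous (radHom V hX) := by
  intro L hL
  by_cases h : L ≤ radHom V hX
  · rw [sup_eq_left.2 h] at hL
    exact absurd hL (radHom_ne_top hX hV)
  · obtain ⟨x, hx, hx'⟩ := SetLike.not_le_iff_exists.1 h
    exact eq_top_of_not_mem_radHom hX hx hx'

theorem isSimpleModule_quotient_radHom (hX : IsIndecomposableModule A X) (hV : IsSummand A X V) :
    IsSimpleModule (Module.End A V)ᵐᵒᵖ (HomMod A V X ⧸ radHom V hX) := by
  rw [isSimpleModule_iff_isCoatom]
  refine ⟨radHom_ne_top hX hV, fun L hL => ?_⟩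
  obtain ⟨x, hx, hx'⟩ := SetLike.exists_of_lt hL
  exact eq_top_of_not_mem_radHom hX hx hx'

end Radical

/-! ### The simple `End(M ⊕ X)`-module attached to an Auslander–Reiten sequence. -/

namespace IsARSequence

variable {A : Type u} [Ring A] {X M Y : Type u} [AddCommGroup X] [Module A X]
  [AddCommGroup M] [Module A M] [AddCommGroup Y] [Module A Y] {f : X →ₗ[A] M} {g : M →ₗ[A] Y}

theorem exists_comp_eq_of_isNilpotent (h : IsARSequence f g) {t : Module.End A X}
    (ht : IsNilpotent t) : ∃ t' : M →ₗ[A] X, t' ∘ₗ f = t := by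
  have := h.finite_left
  have := h.indec_left.1
  exact h.left_almost_split X t fun ⟨r, hr⟩ => ht.not_comp_eq_id hr

/-- An endomorphism is determined by its values on finitely many generators. This makes `End(M ⊕ X)`
an Artin algebra, as `exists_smul_eq_artinDual` requires. -/
theorem finite_end {R : Type u} [CommRing R] [IsArtinianRing R] [Algebra R A] [Module.Finite R A]
    [Module R X] [IsScalarTower R A X] [Module R M] [IsScalarTower R A M] (h : IsARSequence f g) :
    Module.Finite R (Module.End A (M × X))ᵐᵒᵖ := by
  have := h.finite_left
  have := h.finite_mid
  have : Module.Finite R (M × X) := Module.Finite.trans A _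
  obtain ⟨n, s, hs⟩ := Module.Finite.exists_fin (R := A) (M := M × X)
  let F : (Module.End A (M × X))ᵐᵒᵖ →ₗ[R] (Fin n → M × X) :=
    { toFun := fun b k => b.unop (s k)
      map_add' := fun _ _ => rfl
      map_smul' := fun _ _ => rfl }
  refine Module.Finite.of_injective F ?_
  rw [injective_iff_map_eq_zero]
  intro b hb
  apply MulOpposite.unop_injective
  refine LinearMap.ext_on_range hs fun k => ?_
  exact congrFun hb k

variable [IsArtinianRing A]

/-- The radical of the projective module `Hom_A(M ⊕ X, X)`. -/
def rad (h : IsARSequence f g) : Submodule (Module.End A (M × X))ᵐᵒᵖ (HomMod A (M × X) X) :=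
  have := h.isArtinian_left
  have := h.isNoetherian_left
  radHom (M × X) h.indec_left

theorem mem_rad (h : IsARSequence f g) {x : HomMod A (M × X) X} :
    x ∈ h.rad ↔ ∀ k : X →ₗ[A] M × X, IsNilpotent (x.toLin ∘ₗ k : Module.End A X) := Iff.rfl

/-- The simple top of the projective module `Hom_A(M ⊕ X, X)`. -/
abbrev Top (h : IsARSequence f g) : Type u := HomMod A (M × X) X ⧸ h.rad

theorem rad_ne_top (h : IsARSequence f g) : h.rad ≠ ⊤ :=
  have := h.isArtinian_left
  have := h.isNoetherian_left
  radHom_ne_top h.indec_left (isSummand_prod_right M X)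

theorem isSimpleModule_top (h : IsARSequence f g) :
    IsSimpleModule (Module.End A (M × X))ᵐᵒᵖ h.Top :=
  have := h.isArtinian_left
  have := h.isNoetherian_left
  isSimpleModule_quotient_radHom h.indec_left (isSummand_prod_right M X)

theorem isProjectiveCover_top (h : IsARSequence f g) : IsProjectiveCover h.rad.mkQ where
  projective := HomMod.projective (isSummand_prod_right M X).inAdd
  surjective := Submodule.mkQ_surjective _
  superfluous := by
    have := h.isArtinian_left
    have := h.isNoetherian_left
    rw [Submodule.ker_mkQ]
    exact isSuperfluous_radHom h.indec_left (isSummand_prod_right M X)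

theorem of_comp_fst_mem_rad (h : IsARSequence f g) (a : M →ₗ[A] X) :
    HomMod.of (a ∘ₗ LinearMap.fst A M X) ∈ h.rad :=
  h.mem_rad.2 fun k => h.isNilpotent_comp_comp (LinearMap.fst A M X ∘ₗ k) a

/-- The projection of `M ⊕ X` to `M`, viewed as an idempotent of the endomorphism ring. -/
def idem (A : Type u) [Ring A] (M X : Type u) [AddCommGroup X] [Module A X]
    [AddCommGroup M] [Module A M] : (Module.End A (M × X))ᵐᵒᵖ :=
  MulOpposite.op (LinearMap.inl A M X ∘ₗ LinearMap.fst A M X)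

theorem idem_smul (h : IsARSequence f g) (s : h.Top) : idem A M X • s = 0 := by
  obtain ⟨u, rfl⟩ := Submodule.mkQ_surjective _ s
  exact (Submodule.Quotient.mk_eq_zero _).2
    (h.of_comp_fst_mem_rad (u.toLin ∘ₗ LinearMap.inl A M X))

/-- `Hom(V, M)` is generated by the projection onto `M`, which the idempotent at `M` fixes; that
idempotent annihilates the top. -/
theorem map_eq_zero (h : IsARSequence f g)
    (θ : HomMod A (M × X) M →ₗ[(Module.End A (M × X))ᵐᵒᵖ] h.Top) : θ = 0 := by
  ext x
  have h1 : x = (MulOpposite.op (LinearMap.inl A M X ∘ₗ x.toLin) : (Module.End A (M × X))ᵐᵒᵖ) •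
      idem A M X • HomMod.of (LinearMap.fst A M X) := rfl
  rw [h1, map_smul, map_smul, h.idem_smul, smul_zero]
  rfl

/-- Otherwise the projection of `Hom(V, X)` onto its top would extend along `Hom(V, f)` to a map
from `Hom(V, M)`, which must vanish. -/
theorem not_injective_top (h : IsARSequence f g) :
    ¬ Module.Injective (Module.End A (M × X))ᵐᵒᵖ h.Top := by
  intro hinj
  obtain ⟨θ, hθ⟩ := hinj.out (homModMap (M × X) f) (HomMod.map_injective h.injective) h.rad.mkQ
  rw [h.map_eq_zero θ] at hθ
  apply h.rad_ne_top
  rw [eq_top_iff]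
  intro x _
  exact (Submodule.Quotient.mk_eq_zero _).1 (hθ x).symm

/-- The component at `X` of a radical map is nilpotent, hence of the form `t ∘ f`. So the radical is
generated by maps factoring through the projection to `M`, and these are fixed by an idempotent that
kills the top. -/
theorem map_rad_eq_zero (h : IsARSequence f g)
    (θ : h.rad →ₗ[(Module.End A (M × X))ᵐᵒᵖ] h.Top) : θ = 0 := by
  ext ⟨x, hx⟩
  obtain ⟨t, ht⟩ := h.exists_comp_eq_of_isNilpotent (h.mem_rad.1 hx (LinearMap.inr A M X))
  let u (a : M →ₗ[A] X) : h.rad := ⟨_, h.of_comp_fst_mem_rad a⟩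
  have hu : ∀ a, θ (u a) = 0 := fun a => by
    have h1 : u a = idem A M X • u a := rfl
    rw [h1, map_smul, h.idem_smul]
  have h1 : (⟨x, hx⟩ : h.rad) = u (x.toLin ∘ₗ LinearMap.inl A M X) +
      (MulOpposite.op (LinearMap.inl A M X ∘ₗ f ∘ₗ LinearMap.snd A M X) :
        (Module.End A (M × X))ᵐᵒᵖ) • u t := by
    apply Subtype.ext
    refine HomMod.ext fun ⟨m, v⟩ => ?_
    have h2 := LinearMap.congr_fun ht v
    have h3 : x.toLin (m, v) = x.toLin (m, 0) + x.toLin (0, v) := by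
      rw [← map_add]; simp
    exact h3.trans (congrArg (x.toLin (m, 0) + ·) h2.symm)
  rw [h1, map_add, map_smul, hu, hu, smul_zero, add_zero]
  rfl

theorem subsingleton_ext_top (h : IsARSequence f g) :
    Subsingleton (Abelian.Ext.{u} (ModuleCat.of (Module.End A (M × X))ᵐᵒᵖ h.Top)
      (ModuleCat.of (Module.End A (M × X))ᵐᵒᵖ h.Top) 1) := by
  have : Module.Projective (Module.End A (M × X))ᵐᵒᵖ (HomMod A (M × X) X) :=
    h.isProjectiveCover_top.projective
  exact subsingleton_ext_one_quotient h.rad fun θ => ⟨0, by rw [h.map_rad_eq_zero θ]; rfl⟩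

theorem isProjCoverComplement (h : IsARSequence f g) :
    IsProjCoverComplement (Module.End A (M × X))ᵐᵒᵖ h.Top (HomMod A (M × X) M) := by
  refine ⟨ModuleCat.of _ (HomMod A (M × X) X), h.rad.mkQ, h.isProjectiveCover_top, ?_, ?_⟩
  · exact ⟨
      { toFun := fun b => (HomMod.of (LinearMap.snd A M X ∘ₗ b.unop),
          HomMod.of (LinearMap.fst A M X ∘ₗ b.unop))
        map_add' := fun b c => Prod.ext (LinearMap.comp_add b.unop c.unop (LinearMap.snd A M X))
          (LinearMap.comp_add b.unop c.unop (LinearMap.fst A M X))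
        map_smul' := fun _ _ => rfl
        invFun := fun x => MulOpposite.op (x.2.toLin.prod x.1.toLin)
        left_inv := fun _ => rfl
        right_inv := fun _ => rfl }⟩
  · rintro ⟨i, p, hpi⟩
    have h1 := h.map_eq_zero (h.rad.mkQ ∘ₗ p)
    apply h.rad_ne_top
    rw [eq_top_iff]
    intro x _
    refine (Submodule.Quotient.mk_eq_zero _).1 ?_
    have h2 := LinearMap.congr_fun h1 (i x)
    have h3 : p (i x) = x := LinearMap.congr_fun hpi x
    rw [LinearMap.comp_apply, h3] at h2
    exact h2

/-! ### The minimal presentation of `D(S)` and the computation of `τ⁻¹S`. -/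

section TrD

variable (R J : Type u) [CommRing R] [Algebra R A] [Module R X] [IsScalarTower R A X]
  [Module R M] [IsScalarTower R A M] [AddCommGroup J] [Module R J]

variable {J} in
/-- The map `Hom_A(X, M ⊕ X) → D(S)` determined by an element of `D(S)`, where `S` is the top of
`Hom_A(M ⊕ X, X)`. -/
def toDual (h : IsARSequence f g) (φ : ArtinDual R (Module.End A (M × X))ᵐᵒᵖ J h.Top) :
    CoHom A (M × X) X →ₗ[(Module.End A (M × X))ᵐᵒᵖᵐᵒᵖ]
      ArtinDual R (Module.End A (M × X))ᵐᵒᵖ J h.Top :=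
  LinearMap.toSpanSingleton _ _ φ ∘ₗ CoHom.extend (LinearMap.snd A M X)

variable {R J}

theorem toDual_eval (h : IsARSequence f g) (φ : ArtinDual R (Module.End A (M × X))ᵐᵒᵖ J h.Top)
    (k : CoHom A (M × X) X) (u : HomMod A (M × X) X) :
    (h.toDual R φ k).eval (h.rad.mkQ u) =
      φ.eval (h.rad.mkQ (HomMod.of (u.toLin ∘ₗ k.toLin ∘ₗ LinearMap.snd A M X))) := rfl

theorem mkQ_of_comp_snd (h : IsARSequence f g) (u : HomMod A (M × X) X) :
    h.rad.mkQ (HomMod.of (u.toLin ∘ₗ LinearMap.inr A M X ∘ₗ LinearMap.snd A M X)) =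
      h.rad.mkQ u := by
  rw [← sub_eq_zero, ← map_sub, ← neg_eq_zero, ← map_neg]
  refine (Submodule.Quotient.mk_eq_zero _).2 ?_
  convert h.of_comp_fst_mem_rad (u.toLin ∘ₗ LinearMap.inl A M X) using 1
  refine HomMod.ext fun ⟨m, v⟩ => ?_
  have h3 : u.toLin (m, v) = u.toLin (m, 0) + u.toLin (0, v) := by
    rw [← map_add]; simp
  change -(u.toLin (0, v) - u.toLin (m, v)) = u.toLin (m, 0)
  rw [h3]
  abel

/-- Both the kernel and the image consist of the maps `X → M ⊕ X` that are not split monomorphisms: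
such maps factor through `f`, while a retraction of `k` would force `φ = 0`. -/
theorem exact_toDual (h : IsARSequence f g) {φ : ArtinDual R (Module.End A (M × X))ᵐᵒᵖ J h.Top}
    (hφ : φ ≠ 0) : Function.Exact (CoHom.comap (M × X) f) (h.toDual R φ) := by
  have := h.finite_left
  have := h.finite_mid
  intro k
  constructor
  · intro hk
    obtain ⟨k', hk'⟩ := h.left_almost_split (M × X) k.toLin (by
      rintro ⟨r, hr⟩
      apply hφ
      apply ArtinDual.ext
      intro s
      obtain ⟨u, rfl⟩ := Submodule.mkQ_surjective _ s
      have h1 := h.toDual_eval φ k (HomMod.of (u.toLin ∘ₗ LinearMap.inr A M X ∘ₗ r))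
      rw [hk, ArtinDual.eval_zero] at h1
      have h2 : HomMod.of ((HomMod.of (u.toLin ∘ₗ LinearMap.inr A M X ∘ₗ r)).toLin ∘ₗ
          k.toLin ∘ₗ LinearMap.snd A M X) =
          HomMod.of (u.toLin ∘ₗ LinearMap.inr A M X ∘ₗ LinearMap.snd A M X) := by
        ext v
        exact congrArg (fun z => u.toLin (LinearMap.inr A M X z)) (LinearMap.congr_fun hr v.2)
      rw [h2, h.mkQ_of_comp_snd] at h1
      exact h1.symm)
    exact ⟨CoHom.of k', hk'⟩
  · rintro ⟨k', rfl⟩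
    apply ArtinDual.ext
    intro s
    obtain ⟨u, rfl⟩ := Submodule.mkQ_surjective _ s
    rw [toDual_eval, ArtinDual.eval_zero]
    convert map_zero φ.eval
    refine (Submodule.Quotient.mk_eq_zero _).2 (h.mem_rad.2 fun k => ?_)
    exact h.isNilpotent_comp_comp (f ∘ₗ LinearMap.snd A M X ∘ₗ k) (u.toLin ∘ₗ k'.toLin)

theorem isTrD_top [IsArtinianRing R] [Module.Finite R A] (hJ : IsInjectiveEnvelopeOfTop R J)
    (h : IsARSequence f g) :
    IsTrD R (Module.End A (M × X))ᵐᵒᵖ J h.Top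
      (HomMod A (M × X) M ⧸ LinearMap.range (homModMap (M × X) f)) := by
  have := h.isSimpleModule_top
  have := h.finite_end (R := R)
  obtain ⟨φ, hφ⟩ := exists_artinDual_ne_zero (B := (Module.End A (M × X))ᵐᵒᵖ) (S := h.Top) hJ
  have hM : LinearMap.fst A M X ∘ₗ LinearMap.inl A M X = LinearMap.id := rfl
  have hX : LinearMap.snd A M X ∘ₗ LinearMap.inr A M X = LinearMap.id := rfl
  refine ⟨ModuleCat.of _ (CoHom A (M × X) M), ModuleCat.of _ (CoHom A (M × X) X),
    CoHom.comap (M × X) f, h.toDual R φ, ?_, ?_⟩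
  · refine ⟨CoHom.finite hM, CoHom.finite hX, CoHom.projective hM, h.exact_toDual hφ, ?_,
      CoHom.projective hX, ?_, ?_⟩
    -- A map killed by `f` factors through `g`, and composites `Y → M → Y` ending in `g` are
    -- nilpotent because `g` does not split.
    · refine CoHom.isSuperfluous hM fun k hk => ?_
      obtain ⟨k', hk'⟩ := h.exact.exists_desc h.surjective k.toLin hk
      rw [← hk', ← LinearMap.comp_assoc]
      exact isNilpotent_comp_swap (h.isNilpotent_comp_right _)
    · intro ψ
      obtain ⟨b, rfl⟩ := exists_smul_eq_artinDual hJ hφ ψ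
      refine ⟨CoHom.of (b.unop ∘ₗ LinearMap.inr A M X), ArtinDual.ext fun s => ?_⟩
      obtain ⟨u, rfl⟩ := Submodule.mkQ_surjective _ s
      rw [toDual_eval, ArtinDual.eval_smul]
      exact congrArg φ.eval (h.mkQ_of_comp_snd (b • u))
    · refine CoHom.isSuperfluous hX fun k hk => ?_
      obtain ⟨k', rfl⟩ := (h.exact_toDual hφ k).1 hk
      exact h.isNilpotent_comp_left (LinearMap.snd A M X ∘ₗ k'.toLin)
  -- Under `Hom(V, U) ≅ Hom(U, V)*` the dual of precomposition with `f` is `Hom(V, f)`, so the two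
  -- cokernels agree.
  · refine ⟨Submodule.Quotient.equiv _ _ (CoHom.dualEquiv hM) ?_⟩
    ext y
    constructor
    · rintro ⟨_, ⟨x, rfl⟩, rfl⟩
      exact ⟨CoHom.dualEquiv hX x, rfl⟩
    · rintro ⟨x, rfl⟩
      refine ⟨homModMap (M × X) f ((CoHom.dualEquiv hX).symm x), ⟨_, rfl⟩, ?_⟩
      change CoHom.dualEquiv hM (homModMap (M × X) f _) = _
      rw [CoHom.dualMapRight_comap hX hM, LinearEquiv.apply_symm_apply]

theorem isBBTilting_exchange [IsArtinianRing R] [Module.Finite R A]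
    (hJ : IsInjectiveEnvelopeOfTop R J) (h : IsARSequence f g) :
    IsBBTilting R (Module.End A (M × X))ᵐᵒᵖ J (ExchangeModule M f) := by
  have : Module.Projective (Module.End A (M × X))ᵐᵒᵖ (HomMod A (M × X) X) :=
    HomMod.projective (isSummand_prod_right M X).inAdd
  have : Module.Projective (Module.End A (M × X))ᵐᵒᵖ (HomMod A (M × X) M) :=
    HomMod.projective (isSummand_prod_left M X).inAdd
  refine ⟨ModuleCat.of _ h.Top, ModuleCat.of _ (HomMod A (M × X) M ⧸
    LinearMap.range (homModMap (M × X) f)), ModuleCat.of _ (HomMod A (M × X) M),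
    ⟨h.isSimpleModule_top, h.not_injective_top, h.isTrD_top hJ, ?_, h.subsingleton_ext_top,
      h.isProjCoverComplement⟩, ⟨exchangeEquiv f⟩⟩
  exact hasProjectiveDimensionLE_one (HomMod.map_injective h.injective)
    (LinearMap.exact_iff.2 (Submodule.ker_mkQ _)) (Submodule.mkQ_surjective _)

end TrD

end IsARSequence

/-! ### Lifting radical maps out of a simple projective module. -/

section RadicalLift

variable {A : Type u} [Ring A] [IsArtinianRing A] {S N F : Type u} [AddCommGroup S] [Module A S]
  [AddCommGroup N] [Module A N] [AddCommGroup F] [Module A F]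

theorem isSemisimpleModule_quotient_jacobson_smul (A : Type u) [Ring A] [IsArtinianRing A]
    (N : Type u) [AddCommGroup N] [Module A N] :
    IsSemisimpleModule A (N ⧸ (Ring.jacobson A • ⊤ : Submodule A N)) := by
  have h := Module.isTorsionBySet_quotient_ideal_smul N (Ring.jacobson A)
  let _ := h.module
  exact h.isSemisimpleModule_iff.1 inferInstance

/-- A map from a simple module that is not a split monomorphism has image in the radical. -/
theorem mem_jacobson_smul_of_not_split [IsSimpleModule A S] (f : S →ₗ[A] N)
    (hf : ¬ ∃ r : N →ₗ[A] S, r ∘ₗ f = LinearMap.id) (s : S) :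
    f s ∈ (Ring.jacobson A • ⊤ : Submodule A N) := by
  by_contra hs
  have := isSemisimpleModule_quotient_jacobson_smul A N
  let q := (Ring.jacobson A • ⊤ : Submodule A N).mkQ
  have hq : q ∘ₗ f ≠ 0 := fun h =>
    hs ((Submodule.Quotient.mk_eq_zero _).1 (LinearMap.congr_fun h s))
  have hinj : Function.Injective (q ∘ₗ f) := LinearMap.injective_of_ne_zero hq
  obtain ⟨r, hr⟩ := IsSemisimpleModule.extension_property (q ∘ₗ f) hinj LinearMap.id
  exact hf ⟨r ∘ₗ q, hr⟩

/-- If `S` is simple and projective, a map from `S` that is not a split monomorphism lifts along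
an epimorphism to a map that is not a split monomorphism. -/
theorem exists_lift_not_split [IsSimpleModule A S] [Module.Projective A S] (f : S →ₗ[A] N)
    (hf : ¬ ∃ r : N →ₗ[A] S, r ∘ₗ f = LinearMap.id) (π : F →ₗ[A] N)
    (hπ : Function.Surjective π) :
    ∃ f' : S →ₗ[A] F, π ∘ₗ f' = f ∧ ¬ ∃ r : F →ₗ[A] S, r ∘ₗ f' = LinearMap.id := by
  -- The lift is taken inside `rad(A) F`, which maps onto `rad(A) N`. A map `F → S` kills this
  -- submodule, so it cannot be a retraction of the lift.
  let J : Submodule A F := Ring.jacobson A • ⊤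
  have hmap : J.map π = Ring.jacobson A • ⊤ := by
    rw [Submodule.map_smul'', Submodule.map_top, LinearMap.range_eq_top.2 hπ]
  let π' : J →ₗ[A] (Ring.jacobson A • ⊤ : Submodule A N) :=
    π.restrict fun x hx => hmap ▸ Submodule.mem_map_of_mem hx
  have hπ' : Function.Surjective π' := by
    rintro ⟨y, hy⟩
    rw [← hmap] at hy
    obtain ⟨x, hx, rfl⟩ := hy
    exact ⟨⟨x, hx⟩, rfl⟩
  obtain ⟨f', hf'⟩ := Module.projective_lifting_property π'
    (f.codRestrict _ (mem_jacobson_smul_of_not_split f hf)) hπ'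
  refine ⟨J.subtype ∘ₗ f', ?_, ?_⟩
  · ext s
    exact congrArg Subtype.val (LinearMap.congr_fun hf' s)
  · rintro ⟨r, hr⟩
    have := IsSimpleModule.nontrivial A S
    obtain ⟨s, hs⟩ := exists_ne (0 : S)
    apply hs
    have h1 : (f' s : F) ∈ Module.jacobson A F := Ring.jacobson_smul_top_le A F (f' s).2
    have h2 := Module.map_jacobson_le r (Submodule.mem_map_of_mem h1)
    rw [IsSimpleModule.jacobson_eq_bot, Submodule.mem_bot] at h2
    exact (LinearMap.congr_fun hr s).symm.trans h2

end RadicalLift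

/-! ### Auslander–Reiten sequences starting at a simple projective module. -/

namespace IsARSequence

variable {A : Type u} [Ring A] {S E Z P : Type u} [AddCommGroup S] [Module A S]
  [AddCommGroup E] [Module A E] [AddCommGroup Z] [Module A Z] [AddCommGroup P] [Module A P]
  {f : S →ₗ[A] E} {g : E →ₗ[A] Z}

theorem not_projective_right (h : IsARSequence f g) : ¬ Module.Projective A Z := fun _ =>
  h.not_split (Module.projective_lifting_property g LinearMap.id h.surjective)

/-- A nonzero map onto the simple projective `S` splits, so the indecomposable `Z` would be
isomorphic to `S` and hence projective. -/
theorem map_right_eq_zero (h : IsARSequence f g) [IsSimpleModule A S] [Module.Projective A S]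
    (t : Z →ₗ[A] S) : t = 0 := by
  by_contra ht
  obtain ⟨s, hs⟩ := Module.projective_lifting_property t LinearMap.id
    (LinearMap.surjective_of_ne_zero ht)
  have := h.indec_left.1
  have := h.indec_right.isUnit_of_comp_eq_id hs
  exact h.not_projective_right (Module.Projective.of_split t s this)

theorem not_isSummand_right_of_projective (h : IsARSequence f g) [Module.Projective A P] :
    ¬ IsSummand A Z P := by
  rintro ⟨i, p, hpi⟩
  exact h.not_projective_right (Module.Projective.of_split i p hpi)

theorem map_mid_eq_zero (h : IsARSequence f g) [IsSimpleModule A S] [Module.Projective A S]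
    (t : E →ₗ[A] S) : t = 0 := by
  have h1 : t ∘ₗ f = 0 := by
    by_contra h0
    obtain ⟨s, hs⟩ := Module.projective_lifting_property (t ∘ₗ f) LinearMap.id
      (LinearMap.surjective_of_ne_zero h0)
    have h2 := h.indec_left.1
    have h3 := h.indec_left.isUnit_of_comp_eq_id hs
    exact h.left_not_split ⟨s ∘ₗ t, h3⟩
  obtain ⟨t', ht'⟩ := h.exact.exists_desc h.surjective t h1
  rw [← ht', h.map_right_eq_zero t', LinearMap.zero_comp]

variable [IsArtinianRing A]

/-- Left minimality of `f`: the difference `w - 1` factors as `c ∘ g`, which is nilpotent because `g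
∘ c` is. -/
theorem isUnit_of_comp_eq (h : IsARSequence f g) {w : Module.End A E} (hw : w ∘ₗ f = f) :
    IsUnit w := by
  obtain ⟨c, hc⟩ := h.exact.exists_desc h.surjective (w - 1) (by
    rw [LinearMap.sub_comp, hw]
    exact sub_self f)
  have h1 : w = 1 + c ∘ₗ g := by rw [hc]; abel
  rw [h1]
  exact (isNilpotent_comp_swap (h.isNilpotent_comp_right c)).isUnit_one_add

/-- For `π : Aⁿ → E` onto, `f` lifts to a map into `Aⁿ` that is not a split monomorphism and so
extends to `v : E → Aⁿ`. Then `π ∘ v` fixes `f`, hence is invertible, and `E` is a summand of `Aⁿ`.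
-/
theorem projective_mid (h : IsARSequence f g) [IsSimpleModule A S] [Module.Projective A S] :
    Module.Projective A E := by
  have := h.finite_mid
  obtain ⟨n, π, hπ⟩ := Module.Finite.exists_fin' A E
  obtain ⟨f', hf', hns⟩ := exists_lift_not_split f h.left_not_split π hπ
  obtain ⟨v, hv⟩ := h.left_almost_split _ f' hns
  have hw : (π ∘ₗ v : Module.End A E) ∘ₗ f = f := by
    rw [LinearMap.comp_assoc, hv, hf']
  obtain ⟨s, hs⟩ := (h.isUnit_of_comp_eq hw).exists_left_inverse
  exact Module.Projective.of_split v (s ∘ₗ π) hs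

theorem inAdd_mid (h : IsARSequence f g) [IsSimpleModule A S] [Module.Projective A S]
    (e : A ≃ₗ[A] P × S) : InAdd A P E := by
  have := h.finite_mid
  have := h.projective_mid
  obtain ⟨n, π, hπ⟩ := Module.Finite.exists_fin' A E
  obtain ⟨i, hi⟩ := Module.projective_lifting_property π LinearMap.id hπ
  let a : (Fin n → A) →ₗ[A] (Fin n → P) := (LinearMap.fst A P S ∘ₗ e.toLinearMap).compLeft (Fin n)
  let b : (Fin n → P) →ₗ[A] (Fin n → A) :=
    (e.symm.toLinearMap ∘ₗ LinearMap.inl A P S).compLeft (Fin n)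
  refine ⟨n, a ∘ₗ i, π ∘ₗ b, ?_⟩
  -- There are no nonzero maps `E → S`, so the embedding of `E` in `Aⁿ ≅ Pⁿ ⊕ Sⁿ` has image in `Pⁿ`.
  have hba : ∀ x, b (a (i x)) = i x := by
    intro x
    ext k
    have h1 := LinearMap.congr_fun
      (h.map_mid_eq_zero (LinearMap.snd A P S ∘ₗ e.toLinearMap ∘ₗ LinearMap.proj k ∘ₗ i)) x
    change e.symm ((e (i x k)).1, 0) = i x k
    rw [LinearEquiv.symm_apply_eq]
    exact Prod.ext rfl h1.symm
  ext x
  exact (congrArg π (hba x)).trans (LinearMap.congr_fun hi x)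

/-- The resolution is `0 → S → P ⊕ E → P ⊕ Z → 0` and the coresolution is `0 → A ≅ P ⊕ S → P ⊕ E → Z
→ 0`. Maps from `S` to `P` or `Z` are never split monomorphisms, so they extend along `f`. -/
theorem isTiltingModule_prod (h : IsARSequence f g) [IsSimpleModule A S] [Module.Projective A S]
    (e : A ≃ₗ[A] P × S) (hS : ¬ IsSummand A S P) : IsTiltingModule A (P × Z) := by
  have := h.finite_mid
  have := h.finite_left
  have := h.finite_right
  have := h.projective_mid
  have hP := isSummand_prod_left (A := A) P S
  have : Module.Finite A (P × S) := Module.Finite.equiv e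
  have : Module.Projective A (P × S) := Module.Projective.of_equiv e
  have : Module.Finite A P := hP.inAdd.finite
  have : Module.Projective A P := hP.inAdd.projective
  have hPT := isSummand_prod_left (A := A) P Z
  have hE : InAdd A (P × Z) E := by
    obtain ⟨n, i, p, hpi⟩ := h.inAdd_mid e
    refine ⟨n, (LinearMap.inl A P Z).compLeft (Fin n) ∘ₗ i,
      p ∘ₗ (LinearMap.fst A P Z).compLeft (Fin n), ?_⟩
    exact hpi
  refine isTiltingModule_of_exact (i := LinearMap.inr A P E ∘ₗ f)
    (q := (LinearMap.id : P →ₗ[A] P).prodMap g) (T₀ := P × E) (T₁ := Z)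
    (j := (LinearMap.id : P →ₗ[A] P).prodMap f ∘ₗ e.toLinearMap) (p := g ∘ₗ LinearMap.snd A P E)
    (LinearMap.inr_injective.comp h.injective) ?_
    (Function.Surjective.prodMap Function.surjective_id h.surjective) ?_
    (hPT.inAdd.prod hE) (isSummand_prod_right P Z).inAdd ?_ ?_
    (h.surjective.comp LinearMap.snd_surjective)
  · rintro ⟨a, b⟩
    constructor
    · intro hab
      obtain ⟨x, hx⟩ := (h.exact b).1 (congrArg Prod.snd hab)
      exact ⟨x, Prod.ext (congrArg Prod.fst hab).symm hx⟩
    · rintro ⟨x, hx⟩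
      obtain ⟨rfl, rfl⟩ := Prod.mk.inj hx
      exact Prod.ext rfl (h.exact.apply_apply_eq_zero x)
  · intro k
    obtain ⟨k₁, hk₁⟩ := h.left_almost_split P (LinearMap.fst A P Z ∘ₗ k)
      fun ⟨r, hr⟩ => hS ⟨_, r, hr⟩
    obtain ⟨k₂, hk₂⟩ := h.left_almost_split Z (LinearMap.snd A P Z ∘ₗ k) fun ⟨r, hr⟩ => by
      have := h.indec_left.1
      obtain ⟨s, hs⟩ := exists_ne (0 : S)
      apply hs
      have h1 := LinearMap.congr_fun hr s
      rw [h.map_right_eq_zero r, LinearMap.zero_comp] at h1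
      exact h1.symm
    refine ⟨(k₁.prod k₂) ∘ₗ LinearMap.snd A P E, ?_⟩
    ext s
    · exact LinearMap.congr_fun hk₁ s
    · exact LinearMap.congr_fun hk₂ s
  · exact (Function.Injective.prodMap Function.injective_id h.injective).comp e.injective
  · rintro ⟨a, b⟩
    constructor
    · intro hb
      obtain ⟨x, rfl⟩ := (h.exact b).1 hb
      exact ⟨e.symm (a, x), by simp⟩
    · rintro ⟨x, hx⟩
      obtain ⟨rfl, rfl⟩ := Prod.mk.inj hx
      exact h.exact.apply_apply_eq_zero _

theorem isBBTriple (R J : Type u) [CommRing R] [Algebra R A] [AddCommGroup J] [Module R J]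
    (h : IsARSequence f g) [IsSimpleModule A S] [Module.Projective A S]
    (hinj : ¬ Module.Injective A S) (hZ : IsTrD R A J S Z)
    (e : A ≃ₗ[A] P × S) (hS : ¬ IsSummand A S P) : IsBBTriple R A J S Z P where
  simple := inferInstance
  not_injective := hinj
  isTrD := hZ
  projDim_le_one :=
    have := h.projective_mid
    hasProjectiveDimensionLE_one h.injective h.exact h.surjective
  ext_one_eq_zero := by
    have : Projective (ModuleCat.of A S) := inferInstance
    exact subsingleton_of_forall_eq 0 Abelian.Ext.eq_zero_of_projective
  complement := by
    refine ⟨ModuleCat.of A S, LinearMap.id, ⟨inferInstance, Function.surjective_id, ?_⟩,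
      ⟨e.trans (LinearEquiv.prodComm A P S)⟩, hS⟩
    intro L hL
    simpa using hL

end IsARSequence

/-! ### Identifying the exchange module over `A ≅ End(P ⊕ S)`. -/

section Evaluation

variable {A : Type u} [Ring A] {S E Z P : Type u} [AddCommGroup S] [Module A S]
  [AddCommGroup E] [Module A E] [AddCommGroup Z] [Module A Z] [AddCommGroup P] [Module A P]
  {f : S →ₗ[A] E} {g : E →ₗ[A] Z}

/-- Along `A ≅ P ⊕ S`, the exchange module of `f : S → E` is `P ⊕ Coker f`. -/
theorem exists_exchangeModule_addEquiv (hfg : Function.Exact f g) (hg : Function.Surjective g)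
    (e : A ≃ₗ[A] P × S) :
    ∃ φ : ExchangeModule P f ≃+ P × Z,
      ∀ (a : A) (t : ExchangeModule P f), φ (ringEquivEndOfEquiv e a • t) = a • φ t := by
  -- As `e 1` freely generates `P ⊕ S`, evaluation there is a bijection from maps `P ⊕ S → E ⊕ P`
  -- onto `E ⊕ P`.
  have hgen : ∀ w : E × P, ∃ h : HomMod A (P × S) (E × P), h.toLin (e 1) = w := fun w =>
    ⟨HomMod.of (LinearMap.toSpanSingleton A _ w ∘ₗ e.symm.toLinearMap), by simp⟩
  have hext : ∀ {h k : HomMod A (P × S) (E × P)}, h.toLin (e 1) = k.toLin (e 1) → h = k := by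
    intro h k hk
    ext1 v
    obtain ⟨a, rfl⟩ := e.surjective v
    rw [← mul_one a, ← smul_eq_mul, map_smul, map_smul, hk, map_smul]
  let σ := ringEquivEndOfEquiv e
  -- Transporting the action along the ring isomorphism makes evaluation linear over `End(P ⊕ S)`,
  -- so that the first isomorphism theorem applies.
  let _ : Module (Module.End A (P × S))ᵐᵒᵖ (P × Z) := Module.compHom _ σ.symm.toRingHom
  have hsmul : ∀ (b : (Module.End A (P × S))ᵐᵒᵖ) (x : P × Z), b • x = σ.symm b • x :=
    fun _ _ => rfl
  let q : E × P →ₗ[A] P × Z := (LinearMap.snd A E P).prod (g ∘ₗ LinearMap.fst A E P)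
  let ev : HomMod A (P × S) (E × P) →ₗ[(Module.End A (P × S))ᵐᵒᵖ] P × Z :=
    { toFun := fun h => q (h.toLin (e 1))
      map_add' := fun h k => map_add q _ _
      map_smul' := fun b h => by
        obtain ⟨a, rfl⟩ := σ.surjective b
        rw [RingHom.id_apply, hsmul, σ.symm_apply_apply, ← map_smul, ← map_smul, ← map_smul]
        change q (h.toLin (e (e.symm (e 1) * a))) = _
        rw [e.symm_apply_apply, one_mul, smul_eq_mul, mul_one] }
  have hev : Function.Surjective ev := by
    rintro ⟨p, z⟩
    obtain ⟨y, rfl⟩ := hg z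
    obtain ⟨h, hh⟩ := hgen (y, p)
    exact ⟨h, congrArg q hh⟩
  have hker : LinearMap.range (homModMap (P × S) (LinearMap.inl A E P ∘ₗ f)) =
      LinearMap.ker ev := by
    ext h
    constructor
    · rintro ⟨x, rfl⟩
      exact Prod.ext rfl (hfg.apply_apply_eq_zero _)
    · intro hh
      have h1 : (h.toLin (e 1)).2 = 0 := congrArg Prod.fst hh
      obtain ⟨x, hx⟩ := (hfg _).1 (congrArg Prod.snd hh)
      refine ⟨HomMod.of (LinearMap.toSpanSingleton A _ x ∘ₗ e.symm.toLinearMap), hext ?_⟩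
      refine Prod.ext ?_ h1.symm
      change f (e.symm (e 1) • x) = _
      rw [e.symm_apply_apply, one_smul]
      exact hx
  let φ := (Submodule.quotEquivOfEq _ _ hker).trans (ev.quotKerEquivOfSurjective hev)
  refine ⟨φ.toAddEquiv, fun a t => ?_⟩
  exact (φ.map_smul (σ a) t).trans (by rw [hsmul, σ.symm_apply_apply]; rfl)

end Evaluation

theorem proposition4p1 {R A J : Type u} [CommRing R] [IsArtinianRing R] [Ring A] [Algebra R A]
    [Module.Finite R A] [AddCommGroup J] [Module R J] (hJ : IsInjectiveEnvelopeOfTop R J) :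
    -- Auslander-Reiten sequences give BB-tilting modules
    (∀ (X M Y : Type u) [AddCommGroup X] [Module A X] [Module R X] [IsScalarTower R A X]
      [AddCommGroup M] [Module A M] [Module R M] [IsScalarTower R A M]
      [AddCommGroup Y] [Module A Y] (f : X →ₗ[A] M) (g : M →ₗ[A] Y),
      IsARSequence f g →
        IsAlmostAddSplit M f g ∧
        DerivedEquivalentVia (Module.End A (M × X))ᵐᵒᵖ (Module.End A (M × Y))ᵐᵒᵖ
          (ExchangeModule M f) ∧
        IsBBTilting R (Module.End A (M × X))ᵐᵒᵖ J (ExchangeModule M f)) ∧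
    -- the case of an APR-tilting module
    (∀ (S P' Z P : Type u) [AddCommGroup S] [Module A S] [AddCommGroup P'] [Module A P']
      [AddCommGroup Z] [Module A Z] [AddCommGroup P] [Module A P]
      (f : S →ₗ[A] P') (g : P' →ₗ[A] Z) (e : A ≃ₗ[A] P × S),
      IsSimpleModule A S → Module.Projective A S → ¬ Module.Injective A S →
      IsTrD R A J S Z → ¬ IsSummand A S P → IsARSequence f g →
        IsAlmostAddSplit P f g ∧
        IsBBTriple R A J S Z P ∧
        DerivedEquivalentVia A (Module.End A (P × Z))ᵐᵒᵖ (P × Z) ∧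
        ∃ φ : ExchangeModule P f ≃+ P × Z,
          ∀ (a : A) (t : ExchangeModule P f), φ (ringEquivEndOfEquiv e a • t) = a • φ t) := by
  have : IsArtinianRing A :=
    have : IsArtinian R A := inferInstance
    isArtinian_of_tower R this
  constructor
  · intro X M Y _ _ _ _ _ _ _ _ _ _ f g h
    have := h.finite_left
    have := h.finite_mid
    have := h.finite_right
    have hs := h.isAlmostAddSplit M (InAdd.refl M) h.not_isSummand_left h.not_isSummand_right
    exact ⟨hs, derivedEquivalentVia_exchange h.injective h.exact h.surjective
      (hs.left_approx M (InAdd.refl M)) (hs.right_approx M (InAdd.refl M)),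
      h.isBBTilting_exchange hJ⟩
  · intro S P' Z P _ _ _ _ _ _ _ _ f g e hS hproj hinj hZ hSP h
    have hP := (isSummand_prod_left (A := A) P S).trans_inAdd
      (isSummand_of_linearEquiv e.symm).inAdd
    have := hP.finite
    have := hP.projective
    exact ⟨h.isAlmostAddSplit P (h.inAdd_mid e) hSP h.not_isSummand_right_of_projective,
      h.isBBTriple R J hinj hZ e hSP, ⟨h.isTiltingModule_prod e hSP, ⟨RingEquiv.refl _⟩⟩,
      exists_exchangeModule_addEquiv h.exact h.surjective e⟩
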